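/- For complex numbers \(q, x\) with \(|q|<1\) let \[ \Theta(q,x)=\sum_{j=0}^{\infty} q^{j(j+1)/2}x^j \] be the partial theta function, and let \[ \operatorname{Spec}(\Theta)=\{q\in\mathbb C:\ |q|<1 \text{ and there is } x\in\mathbb C \text{ with } \Theta(q,x)=\partial_x\Theta(q,x)=0\} \] be its complex spectrum. Let \(\mathbb T=\{\zeta\in\mathbb C: |\zeta|=1\}\) be the unit circle. Then every point of \(\mathbb T\) is an accumulation point of \(\operatorname{Spec}(\Theta)\), and \[ \overline{\operatorname{Spec}(\Theta)}\cap\mathbb T=\mathbb T . \] -/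

import Mathlib

open Filter Topology

noncomputable section

/-- The partial theta function `Θ(q, x) = ∑_{j ≥ 0} q^{j(j+1)/2} x^j`. The series converges absolutely
for every `x` when `‖q‖ < 1`, the only range in which it is used. The exponent is an exact division in
the natural numbers. -/
def partialTheta (q x : ℂ) : ℂ :=
  ∑' j : ℕ, q ^ (j * (j + 1) / 2) * x ^ j

/-- The complex spectrum of the partial theta function: the parameters `q` in the open unit disk for
which `Θ(q, x) = ∂ₓ Θ(q, x) = 0` for some complex number `x`. -/
def partialThetaSpec : Set ℂ :=
  {q | ‖q‖ < 1 ∧ ∃ x : ℂ, partialTheta q x = 0 ∧ deriv (fun y : ℂ => partialTheta q y) x = 0}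

end

open Finset

/-! Roots of unity are dense in the circle, so it suffices to find spectral values in every small
rectangle `0 < Re z < 2ρ`, `|Im z| < 2ρ` of the coordinate `q = w exp (-z)`, where `w ^ n = 1`.
Suppose there are none. Then every root of `Θ(q, ·)` over the rectangle is simple, and any root
continues holomorphically in `z` (`exists_differentiableOn_root_partialTheta`).

Write `Θ` as the bilateral theta series minus the tail `x⁻¹ Θ(q, x⁻¹)`. The bilateral series
vanishes exactly at the points `-q^{-k}` by the triple product and is huge between the far ones,
while the tail is at most 1. So on `Re z = ρ` there is, for large `k`, a root within a relative
error of order `exp (-ρ k² / 2)`, up to lower-order terms in the exponent, of `-q^{-k}`. Roots of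
`Θ` have modulus at least 1/2, so the error of the continued root grows at most like `exp (k Re z)`.
A two-constants estimate (`norm_le_of_small_on_edge`) carries the smallness down to `z = s / k`:
there is still a root `x = -y / q^k` with `y → 1` (`exists_root_near_neg_inv_pow`).

Let `k` run through multiples of `n`, so that `q^k = exp (-s)` and `x⁻¹ → -exp (-s)`. At the root
the bilateral series equals the tail, which tends to `-exp (-s) Θ(w, -exp (-s))`, and `s` can be
chosen to make this nonzero. But since `w ^ n = 1`, the zeros `-q^{-nj}` crowd along the real axis
near `-1`, which makes the bilateral series exponentially small at the same points
(`norm_fullTheta_neg_div_pow_le`). This is a contradiction. -/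

/-! ### Convergence and the functional equation of the partial theta series -/

theorem triangle_succ (j : ℕ) : (j + 1) * (j + 1 + 1) / 2 = j * (j + 1) / 2 + (j + 1) := by
  rw [show (j + 1) * (j + 1 + 1) = j * (j + 1) + 2 * (j + 1) by ring,
    Nat.add_mul_div_left _ _ two_pos]

theorem triangle_cast (j : ℕ) : ((j * (j + 1) / 2 : ℕ) : ℝ) = j * (j + 1) / 2 := by
  rw [Nat.cast_div (Nat.even_mul_succ_self j).two_dvd (by norm_num)]
  push_cast; ring

/-- The factor `(j + 1)²` absorbs the coefficients `j(j+1)/2` and `j` created by differentiating in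
`q` and `x`. -/
theorem summable_sq_mul_pow_triangle {b : ℝ} (hb0 : 0 < b) (hb : b < 1) {R : ℝ} (hR : 0 < R) :
    Summable fun j : ℕ => ((j : ℝ) + 1) ^ 2 * (b ^ (j * (j + 1) / 2) * R ^ j) := by
  refine summable_of_ratio_test_tendsto_lt_one (l := 0) one_pos
    (Eventually.of_forall fun j => by positivity) ?_
  have h1 : Tendsto (fun j : ℕ => 4 * (b ^ (j + 1) * R)) atTop (𝓝 0) := by
    have := ((tendsto_pow_atTop_nhds_zero_of_lt_one hb0.le hb).comp
      (tendsto_add_atTop_nat 1)).mul_const R |>.const_mul 4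
    simpa using this
  refine squeeze_zero (fun j => by positivity) (fun j => ?_) h1
  rw [Real.norm_of_nonneg (by positivity), Real.norm_of_nonneg (by positivity), triangle_succ,
    div_le_iff₀ (by positivity)]
  have h2 : (((j + 1 : ℕ) : ℝ) + 1) ^ 2 ≤ 4 * ((j : ℝ) + 1) ^ 2 := by
    push_cast; nlinarith [(Nat.cast_nonneg j : (0 : ℝ) ≤ j)]
  calc (((j + 1 : ℕ) : ℝ) + 1) ^ 2 * (b ^ (j * (j + 1) / 2 + (j + 1)) * R ^ (j + 1))
      ≤ (4 * ((j : ℝ) + 1) ^ 2) * (b ^ (j * (j + 1) / 2 + (j + 1)) * R ^ (j + 1)) := by gcongr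
    _ = _ := by rw [pow_add, pow_succ R]; ring

theorem summable_pow_triangle {b : ℝ} (hb0 : 0 < b) (hb : b < 1) {R : ℝ} (hR : 0 < R) :
    Summable fun j : ℕ => b ^ (j * (j + 1) / 2) * R ^ j := by
  refine (summable_sq_mul_pow_triangle hb0 hb hR).of_nonneg_of_le (fun j => by positivity)
    fun j => le_mul_of_one_le_left (by positivity) ?_
  nlinarith [(Nat.cast_nonneg j : (0 : ℝ) ≤ j)]

theorem exists_pow_triangle_bound {q : ℂ} (hq : ‖q‖ < 1) (x : ℂ) :
    ∃ b R : ℝ, 0 < b ∧ b < 1 ∧ 0 < R ∧ ‖q‖ < b ∧ ‖x‖ < R :=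
  ⟨(‖q‖ + 1) / 2, ‖x‖ + 1, by positivity, by linarith, by positivity, by linarith, by linarith⟩

theorem summable_partialTheta {q : ℂ} (hq : ‖q‖ < 1) (x : ℂ) :
    Summable fun j : ℕ => q ^ (j * (j + 1) / 2) * x ^ j := by
  obtain ⟨b, R, hb0, hb, hR, hqb, hxR⟩ := exists_pow_triangle_bound hq x
  refine Summable.of_norm_bounded (summable_pow_triangle hb0 hb hR) fun j => ?_
  rw [norm_mul, norm_pow, norm_pow]
  gcongr

theorem partialTheta_eq {q : ℂ} (hq : ‖q‖ < 1) (x : ℂ) :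
    partialTheta q x = 1 + q * x * partialTheta q (q * x) := by
  unfold partialTheta
  rw [(summable_partialTheta hq x).tsum_eq_zero_add, ← tsum_mul_left]
  simp only [triangle_succ]
  congr 1
  · simp
  · refine tsum_congr fun j => ?_
    rw [mul_pow]; ring

theorem norm_partialTheta_le {q x : ℂ} (hq : ‖q‖ ≤ 1) (hx : ‖x‖ < 1) :
    ‖partialTheta q x‖ ≤ (1 - ‖x‖)⁻¹ := by
  refine tsum_of_norm_bounded (hasSum_geometric_of_lt_one (norm_nonneg x) hx) fun j => ?_
  rw [norm_mul, norm_pow, norm_pow]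
  exact mul_le_of_le_one_left (by positivity) (pow_le_one₀ (norm_nonneg _) hq)

/-- At a root, `q x Θ(q, qx) = -1`, whereas for `‖x‖ < 1/2` the last factor is at most 2. This lower
bound controls the inverse of a continued root. -/
theorem half_le_norm_of_partialTheta_eq_zero {q x : ℂ} (hq : ‖q‖ < 1) (h : partialTheta q x = 0) :
    1 / 2 ≤ ‖x‖ := by
  by_contra! hx
  have hqx : ‖q * x‖ ≤ ‖x‖ := by
    rw [norm_mul]; exact mul_le_of_le_one_left (norm_nonneg _) hq.le
  have h1 := norm_partialTheta_le hq.le (x := q * x) (by linarith)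
  have h2 : ‖q * x * partialTheta q (q * x)‖ = 1 := by
    have := partialTheta_eq hq x
    rw [h] at this
    rw [show q * x * partialTheta q (q * x) = -1 by linear_combination -this]
    simp
  have h3 : (1 - ‖q * x‖)⁻¹ ≤ 2 := by
    rw [inv_le_comm₀ (by linarith) (by norm_num)]; linarith
  rw [norm_mul] at h2
  nlinarith [norm_nonneg (q * x), norm_nonneg (partialTheta q (q * x))]

/-! ### Joint holomorphy in `q` and `x` -/

/-- The derivative of the `j`-th term of the partial theta function in both variables. -/
noncomputable def partialThetaTermFDeriv (j : ℕ) (p : ℂ × ℂ) : ℂ × ℂ →L[ℂ] ℂ :=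
  (((j * (j + 1) / 2 : ℕ) : ℂ) * p.1 ^ (j * (j + 1) / 2 - 1) * p.2 ^ j) • .fst ℂ ℂ ℂ +
    (p.1 ^ (j * (j + 1) / 2) * ((j : ℂ) * p.2 ^ (j - 1))) • .snd ℂ ℂ ℂ

theorem hasFDerivAt_partialTheta_term (j : ℕ) (p : ℂ × ℂ) :
    HasFDerivAt (fun p : ℂ × ℂ => p.1 ^ (j * (j + 1) / 2) * p.2 ^ j)
      (partialThetaTermFDeriv j p) p := by
  have h1 := (hasFDerivAt_fst (𝕜 := ℂ) (p := p)).pow (j * (j + 1) / 2)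
  have h2 := (hasFDerivAt_snd (𝕜 := ℂ) (p := p)).pow j
  refine (h1.mul h2).congr_fderiv ?_
  ext
  · simp [partialThetaTermFDeriv]; ring
  · simp [partialThetaTermFDeriv]

theorem continuous_partialThetaTermFDeriv (j : ℕ) : Continuous (partialThetaTermFDeriv j) := by
  unfold partialThetaTermFDeriv; fun_prop

theorem norm_partialThetaTermFDeriv_le {b R : ℝ} (hb0 : 0 < b) (hR : 0 < R) (j : ℕ)
    {p : ℂ × ℂ} (h1 : ‖p.1‖ ≤ b) (h2 : ‖p.2‖ ≤ R) :
    ‖partialThetaTermFDeriv j p‖ ≤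
      (b⁻¹ + R⁻¹) * (((j : ℝ) + 1) ^ 2 * (b ^ (j * (j + 1) / 2) * R ^ j)) := by
  have hpow : ∀ (c : ℝ) (m : ℕ), 0 < c → (m : ℝ) * c ^ (m - 1) = m * (c⁻¹ * c ^ m) := by
    intro c m hc
    rcases m with _ | m
    · simp
    · simp only [Nat.add_sub_cancel, pow_succ]; field_simp
  have hj : (0 : ℝ) ≤ j := Nat.cast_nonneg j
  set m := j * (j + 1) / 2 with hm
  have hmj : (m : ℝ) ≤ ((j : ℝ) + 1) ^ 2 := by rw [hm, triangle_cast]; nlinarith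
  have hjj : (j : ℝ) ≤ ((j : ℝ) + 1) ^ 2 := by nlinarith
  have hf : ‖ContinuousLinearMap.fst ℂ ℂ ℂ‖ ≤ 1 := ContinuousLinearMap.norm_fst_le ..
  have hs : ‖ContinuousLinearMap.snd ℂ ℂ ℂ‖ ≤ 1 := ContinuousLinearMap.norm_snd_le ..
  calc ‖partialThetaTermFDeriv j p‖
      ≤ ‖((m : ℕ) : ℂ) * p.1 ^ (m - 1) * p.2 ^ j‖ * 1 +
        ‖p.1 ^ m * ((j : ℂ) * p.2 ^ (j - 1))‖ * 1 := by
        refine (norm_add_le _ _).trans (add_le_add ?_ ?_) <;> rw [norm_smul] <;> gcongr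
    _ = (m * ‖p.1‖ ^ (m - 1)) * ‖p.2‖ ^ j + ‖p.1‖ ^ m * (j * ‖p.2‖ ^ (j - 1)) := by
        simp [norm_pow]
    _ ≤ (m * b ^ (m - 1)) * R ^ j + b ^ m * (j * R ^ (j - 1)) := by gcongr
    _ = m * (b⁻¹ * (b ^ m * R ^ j)) + j * (R⁻¹ * (b ^ m * R ^ j)) := by
        rw [hpow b m hb0, hpow R j hR]; ring
    _ ≤ ((j : ℝ) + 1) ^ 2 * (b⁻¹ * (b ^ m * R ^ j)) +
        ((j : ℝ) + 1) ^ 2 * (R⁻¹ * (b ^ m * R ^ j)) := by gcongr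
    _ = _ := by ring

/-- Termwise differentiation on a product of balls; continuity of the derivative upgrades it to the
strict form that the implicit function theorem needs. -/
theorem hasStrictFDerivAt_partialTheta {p : ℂ × ℂ} (hp : ‖p.1‖ < 1) :
    HasStrictFDerivAt (fun p : ℂ × ℂ => partialTheta p.1 p.2)
      (∑' j, partialThetaTermFDeriv j p) p := by
  obtain ⟨b, R, hb0, hb, hR, hqb, hxR⟩ := exists_pow_triangle_bound hp p.2
  let s : Set (ℂ × ℂ) := Metric.ball 0 b ×ˢ Metric.ball 0 R
  have hs : IsOpen s := Metric.isOpen_ball.prod Metric.isOpen_ball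
  have hc : IsPreconnected s :=
    ((convex_ball (0 : ℂ) b).prod (convex_ball (0 : ℂ) R)).isPreconnected
  have hps : p ∈ s := by simp [s, hqb, hxR]
  have hu := (summable_sq_mul_pow_triangle hb0 hb hR).mul_left (b⁻¹ + R⁻¹)
  have hbd : ∀ (j : ℕ) (p : ℂ × ℂ), p ∈ s → ‖partialThetaTermFDeriv j p‖ ≤ _ := fun j p hp =>
    norm_partialThetaTermFDeriv_le hb0 hR j (p := p) (by simpa using (mem_ball_zero_iff.1 hp.1).le)
      (by simpa using (mem_ball_zero_iff.1 hp.2).le)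
  have hcont : ContinuousOn (fun p => ∑' j, partialThetaTermFDeriv j p) s :=
    continuousOn_tsum (fun j => (continuous_partialThetaTermFDeriv j).continuousOn) hu hbd
  refine hasStrictFDerivAt_of_hasFDerivAt_of_continuousAt (f' := fun p => ∑' j, partialThetaTermFDeriv j p) ?_
    (hcont.continuousAt (hs.mem_nhds hps))
  filter_upwards [hs.mem_nhds hps] with y hy
  exact hasFDerivAt_tsum_of_isPreconnected hu hs hc
    (fun j x _ => hasFDerivAt_partialTheta_term j x) hbd hps (summable_partialTheta hp p.2) hy

theorem hasDerivAt_partialTheta {q : ℂ} (hq : ‖q‖ < 1) (x : ℂ) :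
    HasDerivAt (partialTheta q) ((∑' j, partialThetaTermFDeriv j (q, x)) (0, 1)) x := by
  have h := (hasStrictFDerivAt_partialTheta (p := (q, x)) hq).hasFDerivAt
  exact h.comp_hasDerivAt x ((hasDerivAt_const x q).prodMk (hasDerivAt_id x))

theorem differentiable_partialTheta {q : ℂ} (hq : ‖q‖ < 1) : Differentiable ℂ (partialTheta q) :=
  fun x => (hasDerivAt_partialTheta hq x).differentiableAt

/-! ### Continuation of simple roots by covering spaces -/

/-- Holomorphic continuation of a root of `F z x = 0` along a convex open set on which all roots are
simple, provided no root crosses the boundary circle `‖x‖ = R z`. -/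
theorem exists_differentiableOn_root {F : ℂ × ℂ → ℂ} {F' : ℂ × ℂ → ℂ × ℂ →L[ℂ] ℂ} {V K : Set ℂ}
    {R : ℂ → ℝ} (hV : IsOpen V) (hVc : Convex ℝ V) (hK : IsCompact K) (hVK : V ⊆ K)
    (hR : Continuous R) (hF : ∀ z ∈ K, ∀ x, HasStrictFDerivAt F (F' (z, x)) (z, x))
    (hsimple : ∀ z ∈ V, ∀ x, F (z, x) = 0 → F' (z, x) (0, 1) ≠ 0)
    (hbd : ∀ z ∈ V, ∀ x, ‖x‖ = R z → F (z, x) ≠ 0)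
    {z₀ x₀ : ℂ} (hz₀ : z₀ ∈ V) (hx₀ : ‖x₀‖ ≤ R z₀) (h₀ : F (z₀, x₀) = 0) :
    ∃ ξ : ℂ → ℂ, DifferentiableOn ℂ ξ V ∧ ξ z₀ = x₀ ∧ ∀ z ∈ V, F (z, ξ z) = 0 := by
  have hinv : ∀ z ∈ V, ∀ x, F (z, x) = 0 →
      (F' (z, x) ∘L .inr ℂ ℂ ℂ).IsInvertible := by
    intro z hz x h
    refine ⟨ContinuousLinearEquiv.unitsEquivAut ℂ (Units.mk0 _ (hsimple z hz x h)), ?_⟩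
    ext; simp
  let S : Set (ℂ × ℂ) := {p | p.1 ∈ K ∧ ‖p.2‖ ≤ R p.1 ∧ F p = 0}
  have hFc : ContinuousOn F (K ×ˢ Set.univ) := fun p hp =>
    (hF p.1 hp.1 p.2).continuousAt.continuousWithinAt
  obtain ⟨M, hM⟩ := (hK.image hR).bddAbove
  have hScpt : IsCompact S := by
    have h1 : IsCompact (K ×ˢ Metric.closedBall (0 : ℂ) M) := hK.prod (isCompact_closedBall _ _)
    refine h1.of_isClosed_subset ?_ fun p hp => ⟨hp.1, ?_⟩
    · have h2 : IsClosed ((K ×ˢ Set.univ) ∩ F ⁻¹' {0}) :=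
        hFc.preimage_isClosed_of_isClosed (hK.isClosed.prod isClosed_univ) isClosed_singleton
      have h3 : IsClosed {p : ℂ × ℂ | ‖p.2‖ ≤ R p.1} :=
        isClosed_le (by fun_prop) (hR.comp continuous_fst)
      convert h2.inter h3 using 1
      ext p; simp [S]; tauto
    · simpa using hp.2.1.trans (hM ⟨p.1, hp.1, rfl⟩)
  have : CompactSpace S := isCompact_iff_compactSpace.1 hScpt
  let π : S → ℂ := fun e => e.1.1
  have hπ : Continuous π := by fun_prop
  have hloc : IsLocalHomeomorphOn π (π ⁻¹' V) := by
    rintro ⟨⟨z, x⟩, hzK, hxR, hzx⟩ (hzV : z ∈ V)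
    have hd := hF z hzK x
    have hi := hinv z hzV x hzx
    set ψ := hd.implicitFunctionOfProdDomain hi
    have e1 := hd.eventually_apply_eq_iff_implicitFunctionOfProdDomain hi
    have e2 : ∀ᶠ p : ℂ × ℂ in 𝓝 (z, x), ‖p.2‖ < R p.1 ∧ p.1 ∈ V := by
      have hlt : ‖x‖ < R z := lt_of_le_of_ne hxR fun h => hbd z hzV x h hzx
      have ho : IsOpen {p : ℂ × ℂ | ‖p.2‖ < R p.1} :=
        isOpen_lt (by fun_prop) (hR.comp continuous_fst)
      have h1 : ∀ᶠ p : ℂ × ℂ in 𝓝 (z, x), ‖p.2‖ < R p.1 := ho.mem_nhds hlt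
      exact h1.and (continuousAt_fst.eventually (hV.mem_nhds hzV))
    obtain ⟨N, hN, hNo, hzN⟩ := eventually_nhds_iff.1 (e1.and e2)
    obtain ⟨U, hUz, hU⟩ : ∃ U ∈ 𝓝 z, ContinuousOn ψ U := by
      obtain ⟨c, s, hs, hl⟩ :=
        (hd.hasStrictFDerivAt_implicitFunctionOfProdDomain hi).exists_lipschitzOnWith
      exact ⟨s, hs, hl.continuousOn⟩
    obtain ⟨U', hU'U, hU'o, hzU'⟩ := mem_nhds_iff.1 hUz
    have hψc : ContinuousOn ψ U' := hU.mono hU'U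
    have hψz : ψ z = x := (hN (z, x) hzN).1.1 rfl
    have hzero : ∀ p ∈ N, F p = 0 ↔ ψ p.1 = p.2 := fun p hp => by
      rw [← hzx]; exact (hN p hp).1
    let T : Set ℂ := U' ∩ (fun w => (w, ψ w)) ⁻¹' N
    have hTo : IsOpen T := (continuousOn_id.prodMk hψc).isOpen_inter_preimage hU'o hNo
    have hTS : ∀ w ∈ T, (w, ψ w) ∈ S := fun w hw =>
      ⟨hVK (hN _ hw.2).2.2, (hN _ hw.2).2.1.le, (hzero _ hw.2).2 rfl⟩
    classical
    let φ : OpenPartialHomeomorph S ℂ :=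
      { toFun := π
        -- Outside `T` the value is irrelevant; the given root only serves as an available point of
        -- `S`.
        invFun := fun w => if h : w ∈ T then ⟨(w, ψ w), hTS w h⟩ else ⟨(z, x), hzK, hxR, hzx⟩
        source := {e | e.1 ∈ N ∧ e.1.1 ∈ U'}
        target := T
        map_source' := by
          rintro ⟨⟨w, y⟩, hw⟩ ⟨h1, h2⟩
          have : ψ w = y := (hzero _ h1).1 hw.2.2
          exact ⟨h2, by simpa [this, π] using h1⟩
        map_target' := by
          intro w hw
          simp only [hw, dif_pos]
          exact ⟨hw.2, hw.1⟩
        left_inv' := by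
          rintro ⟨⟨w, y⟩, hw⟩ ⟨h1, h2⟩
          have h3 : ψ w = y := (hzero _ h1).1 hw.2.2
          have h4 : w ∈ T := ⟨h2, by simpa [h3] using h1⟩
          simp [π, h4, h3]
        right_inv' := by
          intro w hw
          simp [π, hw]
        open_source := (hNo.preimage continuous_subtype_val).inter
          (hU'o.preimage (by fun_prop))
        open_target := hTo
        continuousOn_toFun := hπ.continuousOn
        continuousOn_invFun := by
          rw [Topology.IsInducing.subtypeVal.continuousOn_iff]
          have : ContinuousOn (fun w => (w, ψ w)) T :=
            continuousOn_id.prodMk (hψc.mono Set.inter_subset_left)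
          refine this.congr fun w hw => ?_
          simp [hw] }
    exact ⟨φ, ⟨hzN, hzU'⟩, rfl⟩
  -- Compactness of `S` turns the local homeomorphism over `V` into a covering. As `V` is convex,
  -- hence contractible, its inclusion lifts through the given root.
  have hcov : IsCoveringMapOn π V := IsCoveringMapOn.of_isLocalHomeomorphOn hπ hloc
  have : ContractibleSpace V := hVc.contractibleSpace ⟨z₀, hz₀⟩
  have : LocallyPathConnectedSpace V := hV.locallyPathConnectedSpace
  obtain ⟨G, ⟨hG0, hG⟩, -⟩ := hcov.existsUnique_continuousMap_lifts
    (⟨Subtype.val, continuous_subtype_val⟩ : C(V, ℂ)) (a₀ := ⟨z₀, hz₀⟩)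
    (e₀ := ⟨(z₀, x₀), hVK hz₀, hx₀, h₀⟩) rfl (fun a => a.2)
  have hG1 : ∀ v : V, (G v).1.1 = v := fun v => congrFun hG v
  classical
  let ξ : ℂ → ℂ := fun z => if h : z ∈ V then (G ⟨z, h⟩).1.2 else 0
  have hξ : ∀ (z) (hz : z ∈ V), (z, ξ z) = (G ⟨z, hz⟩).1 := by
    intro z hz
    refine Prod.ext (hG1 ⟨z, hz⟩).symm ?_
    simp [ξ, hz]
  have hξ0 : ∀ z ∈ V, F (z, ξ z) = 0 := fun z hz => by rw [hξ z hz]; exact (G ⟨z, hz⟩).2.2.2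
  have hξc : ContinuousOn ξ V := by
    rw [continuousOn_iff_continuous_domRestrict]
    have : V.domRestrict ξ = fun v => (G v).1.2 := by
      ext v; simp [ξ, Set.domRestrict]
    rw [this]; fun_prop
  refine ⟨ξ, fun z hz => ?_, ?_, hξ0⟩
  · have hd := hF z (hVK hz) (ξ z)
    have hi := hinv z hz _ (hξ0 z hz)
    have e1 := hd.eventually_apply_eq_iff_implicitFunctionOfProdDomain hi
    have e2 : Tendsto (fun w => (w, ξ w)) (𝓝 z) (𝓝 (z, ξ z)) :=
      continuousAt_id.prodMk (hξc.continuousAt (hV.mem_nhds hz))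
    have h3 : ξ =ᶠ[𝓝 z] hd.implicitFunctionOfProdDomain hi := by
      filter_upwards [e2.eventually e1, hV.mem_nhds hz] with w hw hwV
      rw [hξ0 w hwV, hξ0 z hz] at hw
      exact (hw.1 rfl).symm
    exact ((hd.hasStrictFDerivAt_implicitFunctionOfProdDomain hi).differentiableAt.congr_of_eventuallyEq
      h3).differentiableWithinAt
  · simp [ξ, hz₀, hG0]

/-! ### The bilateral theta series and its quasi-periodicity -/

/-- The bilateral theta series `∑_{j ∈ ℤ} q^{j(j+1)/2} x^j`, split into its two halves. -/
noncomputable def fullTheta (q x : ℂ) : ℂ := partialTheta q x + x⁻¹ * partialTheta q x⁻¹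

theorem fullTheta_neg_one (q : ℂ) : fullTheta q (-1) = 0 := by
  simp [fullTheta, inv_neg]

theorem fullTheta_mul {q x : ℂ} (hq : ‖q‖ < 1) (hq0 : q ≠ 0) (hx : x ≠ 0) :
    q * x * fullTheta q (q * x) = fullTheta q x := by
  have h1 := partialTheta_eq hq x
  have h2 := partialTheta_eq hq (q * x)⁻¹
  have h3 : q * (q * x)⁻¹ = x⁻¹ := by field_simp
  rw [h3] at h2
  unfold fullTheta
  rw [h1, h2]
  field_simp
  ring

theorem fullTheta_div_pow {q x : ℂ} (hq : ‖q‖ < 1) (hq0 : q ≠ 0) (hx : x ≠ 0) (k : ℕ) :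
    fullTheta q (x / q ^ (k + 1)) = x ^ (k + 1) / q ^ (k * (k + 1) / 2) * fullTheta q x := by
  induction k with
  | zero =>
    have := fullTheta_mul hq hq0 (x := x / q) (by positivity)
    rw [mul_div_cancel₀ _ hq0] at this
    simpa using this.symm
  | succ k ih =>
    have := fullTheta_mul hq hq0 (x := x / q ^ (k + 1 + 1)) (by positivity)
    rw [show q * (x / q ^ (k + 1 + 1)) = x / q ^ (k + 1) by
      rw [pow_succ q (k + 1)]; field_simp, ih] at this
    rw [← this, triangle_succ, pow_add, pow_succ x (k + 1)]
    field_simp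
    ring

theorem fullTheta_neg_inv_pow {q : ℂ} (hq : ‖q‖ < 1) (hq0 : q ≠ 0) (k : ℕ) :
    fullTheta q (-1 / q ^ k) = 0 := by
  rcases k with _ | k
  · simpa using fullTheta_neg_one q
  · rw [fullTheta_div_pow hq hq0 (by simp), fullTheta_neg_one, mul_zero]

theorem partialTheta_eq_fullTheta_sub (q x : ℂ) :
    partialTheta q x = fullTheta q x - x⁻¹ * partialTheta q x⁻¹ := by
  simp [fullTheta]

/-- Away from the closed unit disk, the partial and the bilateral theta series are close. -/
theorem norm_inv_mul_partialTheta_inv_le {q x : ℂ} (hq : ‖q‖ ≤ 1) (hx : 2 ≤ ‖x‖) :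
    ‖x⁻¹ * partialTheta q x⁻¹‖ ≤ 1 := by
  have h1 : ‖x⁻¹‖ ≤ 1 / 2 := by
    rw [norm_inv, inv_le_comm₀ (by linarith) (by norm_num)]; linarith
  have h2 := norm_partialTheta_le hq (x := x⁻¹) (by linarith)
  have h3 : (1 - ‖x⁻¹‖)⁻¹ ≤ 2 := by
    rw [inv_le_comm₀ (by linarith) (by norm_num)]; linarith
  rw [norm_mul]
  nlinarith [norm_nonneg x⁻¹, norm_nonneg (partialTheta q x⁻¹)]

theorem norm_fullTheta_div_pow {q x : ℂ} (hq : ‖q‖ < 1) (hq0 : q ≠ 0) (hx : x ≠ 0) (k : ℕ) :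
    ‖fullTheta q (x / q ^ (k + 1))‖ = ‖x‖ ^ (k + 1) / ‖q‖ ^ (k * (k + 1) / 2) * ‖fullTheta q x‖ := by
  rw [fullTheta_div_pow hq hq0 hx]; simp

/-! ### Gaussian binomials and the finite triple product -/

/-- The Gaussian binomial coefficient. -/
noncomputable def gaussBinom (q : ℂ) : ℕ → ℕ → ℂ
  | _, 0 => 1
  | 0, _ + 1 => 0
  | N + 1, m + 1 => gaussBinom q N (m + 1) + q ^ (N - m) * gaussBinom q N m

/-- The finite `q`-Pochhammer product `∏_{i < n} (1 - q^{i+1})`. -/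
noncomputable def qPoch (q : ℂ) (n : ℕ) : ℂ := ∏ i ∈ range n, (1 - q ^ (i + 1))

theorem qPoch_succ (q : ℂ) (n : ℕ) : qPoch q (n + 1) = qPoch q n * (1 - q ^ (n + 1)) :=
  prod_range_succ _ _

theorem gaussBinom_eq_zero (q : ℂ) {N m : ℕ} (h : N < m) : gaussBinom q N m = 0 := by
  induction N generalizing m with
  | zero => obtain ⟨m, rfl⟩ := Nat.exists_eq_succ_of_ne_zero h.ne'; rfl
  | succ N ih =>
    obtain ⟨m, rfl⟩ := Nat.exists_eq_succ_of_ne_zero (by omega : m ≠ 0)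
    simp only [gaussBinom]
    rw [ih (by omega), ih (by omega)]; simp

theorem gaussBinom_self (q : ℂ) (N : ℕ) : gaussBinom q N N = 1 := by
  induction N with
  | zero => rfl
  | succ N ih => simp [gaussBinom, ih, gaussBinom_eq_zero]

theorem gaussBinom_mul_qPoch (q : ℂ) (m r : ℕ) :
    gaussBinom q (m + r) m * (qPoch q m * qPoch q r) = qPoch q (m + r) := by
  induction m generalizing r with
  | zero => simp [gaussBinom, qPoch]
  | succ m ihm =>
    induction r with
    | zero => simp [gaussBinom_self, qPoch]
    | succ r ihr =>
      have h1 : m + 1 + (r + 1) = (m + r + 1) + 1 := by ring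
      have h2 : m + r + 1 - m = r + 1 := by omega
      have h3 := ihm (r + 1)
      rw [show m + (r + 1) = m + r + 1 by ring] at h3
      rw [show m + 1 + r = m + r + 1 by ring] at ihr
      rw [h1, gaussBinom, h2, qPoch_succ q (m + r + 1)]
      have e : qPoch q (m + 1) * qPoch q (r + 1) = qPoch q (m + 1) * qPoch q r * (1 - q ^ (r + 1)) := by
        rw [qPoch_succ q r]; ring
      have e' : qPoch q (m + 1) * qPoch q (r + 1) = qPoch q m * qPoch q (r + 1) * (1 - q ^ (m + 1)) := by
        rw [qPoch_succ q m]; ring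
      rw [add_mul]
      nth_rewrite 1 [e]
      rw [e']
      linear_combination (1 - q ^ (r + 1)) * ihr + q ^ (r + 1) * (1 - q ^ (m + 1)) * h3

/-- The Gauss (finite) `q`-binomial theorem. -/
theorem prod_one_add_mul_pow (q z : ℂ) (N : ℕ) :
    ∏ i ∈ range N, (1 + z * q ^ (i + 1)) =
      ∑ m ∈ range (N + 1), gaussBinom q N m * q ^ (m * (m + 1) / 2) * z ^ m := by
  induction N with
  | zero => simp [gaussBinom]
  | succ N ih =>
    rw [prod_range_succ, ih, sum_range_succ' _ (N + 1), mul_add, mul_one]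
    have h1 : ∀ m ∈ range (N + 1), gaussBinom q (N + 1) (m + 1) * q ^ ((m + 1) * (m + 1 + 1) / 2)
        * z ^ (m + 1) = gaussBinom q N (m + 1) * q ^ ((m + 1) * (m + 1 + 1) / 2) * z ^ (m + 1) +
        gaussBinom q N m * q ^ (m * (m + 1) / 2) * z ^ m * (z * q ^ (N + 1)) := by
      intro m hm
      have h2 : N + 1 = (N - m) + (m + 1) := by have := mem_range.1 hm; omega
      rw [gaussBinom, triangle_succ, h2, pow_add q (N - m) (m + 1), pow_add,
        pow_succ z]
      ring
    rw [sum_congr rfl h1, sum_add_distrib, ← sum_mul]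
    have h3 := sum_range_succ' (fun m => gaussBinom q N m * q ^ (m * (m + 1) / 2) * z ^ m) (N + 1)
    rw [sum_range_succ _ (N + 1), gaussBinom_eq_zero q (Nat.lt_succ_self N)] at h3
    simp only [zero_mul, add_zero] at h3
    rw [h3]
    simp [gaussBinom]
    ring

theorem triangle_add (n j : ℕ) :
    (n + j) * (n + j + 1) / 2 + n * (n - 1) / 2 = j * (j + 1) / 2 + n * (n + j) := by
  have h1 : ((((n + j) * (n + j + 1) / 2 + n * (n - 1) / 2 : ℕ)) : ℝ) =
      ((j * (j + 1) / 2 + n * (n + j) : ℕ) : ℝ) := by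
    rcases n with _ | n
    · simp
    · rw [Nat.add_sub_cancel, mul_comm (n + 1) n]
      push_cast [triangle_cast]
      have := triangle_cast (n + 1 + j)
      push_cast at this
      ring
  exact_mod_cast h1

theorem triangle_sub (n j : ℕ) :
    n * (n + 1) / 2 + (n + j + 1) * (n + j) / 2 = j * (j + 1) / 2 + (n + j + 1) * n := by
  have h1 : (((n * (n + 1) / 2 + (n + j + 1) * (n + j) / 2 : ℕ)) : ℝ) =
      ((j * (j + 1) / 2 + (n + j + 1) * n : ℕ) : ℝ) := by
    rw [mul_comm (n + j + 1) (n + j)]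
    push_cast [triangle_cast]
    have := triangle_cast (n + j)
    push_cast at this
    ring
  exact_mod_cast h1

theorem prod_one_add_div_pow {q x : ℂ} (hq0 : q ≠ 0) (hx : x ≠ 0) (n : ℕ) :
    ∏ i ∈ range n, (1 + x / q ^ i) =
      x ^ n / q ^ (n * (n - 1) / 2) * ∏ i ∈ range n, (1 + x⁻¹ * q ^ i) := by
  have h : ∀ i ∈ range n, 1 + x / q ^ i = x / q ^ i * (1 + x⁻¹ * q ^ i) := by
    intro i _; field_simp; ring
  rw [prod_congr rfl h, prod_mul_distrib, prod_div_distrib, prod_const, card_range,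
    prod_pow_eq_pow_sum, sum_range_id]

/-- The finite form of the Jacobi triple product identity. -/
theorem prod_mul_prod_eq {q x : ℂ} (hq0 : q ≠ 0) (hx : x ≠ 0) (n : ℕ) :
    (∏ i ∈ range n, (1 + x * q ^ (i + 1))) * ∏ i ∈ range n, (1 + x⁻¹ * q ^ i) =
      (∑ j ∈ range (n + 1), gaussBinom q (n + n) (n + j) * (q ^ (j * (j + 1) / 2) * x ^ j)) +
      x⁻¹ * ∑ j ∈ range n, gaussBinom q (n + n) (n - 1 - j) * (q ^ (j * (j + 1) / 2) * x⁻¹ ^ j) := by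
  -- Centring at `x / q ^ n` makes the first `n` of the `2n` factors the `1 + x / q ^ i` and the
  -- others the `1 + x q ^ (i + 1)`.
  have h := prod_one_add_mul_pow q (x / q ^ n) (n + n)
  rw [prod_range_add, show n + n + 1 = n + (n + 1) by ring, sum_range_add] at h
  have h1 : ∏ i ∈ range n, (1 + x / q ^ n * q ^ (i + 1)) = ∏ i ∈ range n, (1 + x / q ^ i) := by
    rw [← prod_range_reflect]
    refine prod_congr rfl fun i hi => ?_
    have : n = (n - 1 - i + 1) + i := by have := mem_range.1 hi; omega
    have h2 : q ^ n = q ^ (n - 1 - i + 1) * q ^ i := by rw [← pow_add, ← this]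
    rw [h2]; field_simp
  have h2 : ∏ i ∈ range n, (1 + x / q ^ n * q ^ (n + i + 1)) =
      ∏ i ∈ range n, (1 + x * q ^ (i + 1)) := by
    refine prod_congr rfl fun i _ => ?_
    rw [show n + i + 1 = n + (i + 1) by ring, pow_add]; field_simp
  rw [h1, h2, prod_one_add_div_pow hq0 hx] at h
  have h3 : (∏ i ∈ range n, (1 + x * q ^ (i + 1))) * ∏ i ∈ range n, (1 + x⁻¹ * q ^ i) =
      q ^ (n * (n - 1) / 2) / x ^ n * (x ^ n / q ^ (n * (n - 1) / 2) *
        (∏ i ∈ range n, (1 + x⁻¹ * q ^ i)) * ∏ i ∈ range n, (1 + x * q ^ (i + 1))) := by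
    field_simp
  rw [h3, h, add_comm, mul_add, mul_sum, mul_sum, mul_sum]
  congr 1
  · refine sum_congr rfl fun j _ => ?_
    have := congrArg (q ^ ·) (triangle_add n j)
    simp only [pow_add] at this
    rw [div_pow, ← pow_mul, pow_add x]
    field_simp
    linear_combination (gaussBinom q (n + n) (n + j)) * this
  · rw [← sum_range_reflect]
    refine sum_congr rfl fun j hj => ?_
    obtain ⟨m, rfl⟩ : ∃ m, n = m + j + 1 := ⟨n - 1 - j, by have := mem_range.1 hj; omega⟩
    rw [show m + j + 1 - 1 - j = m by omega, show m + j + 1 - 1 = m + j by omega]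
    have := congrArg (q ^ ·) (triangle_sub m j)
    simp only [pow_add] at this
    rw [div_pow, ← pow_mul, pow_succ x, pow_add x m j, inv_pow]
    have h5 : q ^ ((m + j + 1) * m) ≠ 0 := pow_ne_zero _ hq0
    field_simp
    linear_combination (gaussBinom q (m + j + 1 + (m + j + 1)) m) * this

/-! ### Product bounds and the triple product in the limit -/

/-- An explicit positive lower bound for the products `∏_{i < n} (1 - b^{i+1})`. -/
noncomputable def qPochBound (b : ℝ) : ℝ := Real.exp (-((1 - b)⁻¹ * (1 - b)⁻¹))

theorem qPochBound_pos (b : ℝ) : 0 < qPochBound b := Real.exp_pos _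

/-- For `0 ≤ a ≤ b`, `1 / (1 - a) = 1 + a / (1 - a) ≤ exp (a / (1 - b))`; the exponents then sum to
at most a geometric series. -/
theorem qPochBound_le_prod {b : ℝ} (hb0 : 0 ≤ b) (hb : b < 1) (n : ℕ) :
    qPochBound b ≤ ∏ i ∈ range n, (1 - b ^ (i + 1)) := by
  have h1 : ∀ i ∈ range n, Real.exp (-((1 - b)⁻¹ * b ^ (i + 1))) ≤ 1 - b ^ (i + 1) := by
    intro i _
    have ha : b ^ (i + 1) ≤ b := pow_le_of_le_one hb0 hb.le (by simp)
    have ha0 : 0 ≤ b ^ (i + 1) := by positivity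
    set a := b ^ (i + 1)
    have h2 : (1 - a)⁻¹ ≤ Real.exp ((1 - b)⁻¹ * a) := by
      calc (1 - a)⁻¹ = (1 - a)⁻¹ * a + 1 := by
            have : 1 - a ≠ 0 := by linarith
            field_simp; ring
        _ ≤ Real.exp ((1 - a)⁻¹ * a) := Real.add_one_le_exp _
        _ ≤ _ := by
            refine Real.exp_le_exp.2 (mul_le_mul_of_nonneg_right ?_ ha0)
            exact inv_anti₀ (by linarith) (by linarith)
    rw [Real.exp_neg]
    exact inv_le_of_inv_le₀ (by linarith) h2
  refine le_trans ?_ (prod_le_prod (fun i _ => (Real.exp_pos _).le) h1)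
  rw [← Real.exp_sum, qPochBound, Real.exp_le_exp, sum_neg_distrib, ← mul_sum, neg_le_neg_iff]
  refine mul_le_mul_of_nonneg_left ?_ (inv_nonneg.2 (by linarith))
  calc ∑ i ∈ range n, b ^ (i + 1) ≤ ∑ i ∈ range n, b ^ i :=
        sum_le_sum fun i _ => pow_le_pow_of_le_one hb0 hb.le (Nat.le_succ i)
    _ ≤ ∑' i, b ^ i := (summable_geometric_of_lt_one hb0 hb).sum_le_tsum _ fun i _ => by positivity
    _ = _ := tsum_geometric_of_lt_one hb0 hb

/-- Lower bound for products `∏ (1 + z q^i)` with `‖z‖, ‖q‖ ≤ b`. -/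
theorem qPochBound_le_norm_prod {b : ℝ} (hb : b < 1) {q z : ℂ} (hq : ‖q‖ ≤ b) (hz : ‖z‖ ≤ b)
    (n : ℕ) : qPochBound b ≤ ‖∏ i ∈ range n, (1 + z * q ^ i)‖ := by
  have hb0 : 0 ≤ b := (norm_nonneg _).trans hq
  refine (qPochBound_le_prod hb0 hb n).trans ?_
  rw [norm_prod]
  refine prod_le_prod (fun i _ => sub_nonneg.2 (pow_le_one₀ hb0 hb.le)) fun i _ => ?_
  have h1 : ‖z * q ^ i‖ ≤ b ^ (i + 1) := by
    rw [norm_mul, norm_pow, pow_succ']; gcongr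
  have h2 := norm_sub_norm_le (1 : ℂ) (-(z * q ^ i))
  rw [norm_one, norm_neg, sub_neg_eq_add] at h2
  linarith

theorem qPoch_eq (q : ℂ) (n : ℕ) : qPoch q n = ∏ i ∈ range n, (1 + -q * q ^ i) := by
  refine prod_congr rfl fun i _ => ?_
  ring

theorem qPochBound_le_norm_qPoch {b : ℝ} (hb : b < 1) {q : ℂ} (hq : ‖q‖ ≤ b) (n : ℕ) :
    qPochBound b ≤ ‖qPoch q n‖ := by
  rw [qPoch_eq]; exact qPochBound_le_norm_prod hb hq (by simpa using hq) n

/-- Since `1 + a ≤ 1 / (1 - a)`, the upper bound is the inverse of the lower one. -/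
theorem norm_qPoch_le {b : ℝ} (hb : b < 1) {q : ℂ} (hq : ‖q‖ ≤ b) (n : ℕ) :
    ‖qPoch q n‖ ≤ (qPochBound b)⁻¹ := by
  have hb0 : 0 ≤ b := (norm_nonneg _).trans hq
  have h0 := qPochBound_le_prod hb0 hb n
  rw [le_inv_comm₀ (lt_of_lt_of_le (qPochBound_pos b) (qPochBound_le_norm_qPoch hb hq n))
    (qPochBound_pos b)]
  refine h0.trans ?_
  rw [qPoch, norm_prod, ← prod_inv_distrib]
  have hq1 : ∀ i : ℕ, 0 < ‖1 - q ^ (i + 1)‖ ∧ ‖1 - q ^ (i + 1)‖ ≤ 1 + b ^ (i + 1) ∧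
      b ^ (i + 1) < 1 := by
    intro i
    have h1 : ‖q ^ (i + 1)‖ ≤ b ^ (i + 1) := by rw [norm_pow]; gcongr
    have h2 : b ^ (i + 1) < 1 := pow_lt_one₀ hb0 hb (by simp)
    have h3 := norm_sub_norm_le (1 : ℂ) (q ^ (i + 1))
    have h4 := norm_sub_le (1 : ℂ) (q ^ (i + 1))
    rw [norm_one] at h3 h4
    exact ⟨by linarith, by linarith, h2⟩
  refine prod_le_prod (fun i _ => by linarith [(hq1 i).2.2]) fun i _ => ?_
  obtain ⟨h1, h2, h3⟩ := hq1 i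
  rw [le_inv_comm₀ (by linarith) h1]
  refine h2.trans ?_
  rw [← one_div, le_div_iff₀ (by linarith)]
  nlinarith [pow_nonneg hb0 (i + 1)]

theorem norm_gaussBinom_le {b : ℝ} (hb : b < 1) {q : ℂ} (hq : ‖q‖ ≤ b) (N m : ℕ) :
    ‖gaussBinom q N m‖ ≤ (qPochBound b)⁻¹ ^ 3 := by
  have hd := qPochBound_pos b
  rcases lt_or_ge N m with h | h
  · rw [gaussBinom_eq_zero q h]; simp; positivity
  · obtain ⟨r, rfl⟩ := Nat.exists_eq_add_of_le h
    have h1 := congrArg norm (gaussBinom_mul_qPoch q m r)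
    rw [norm_mul, norm_mul] at h1
    have h2 := qPochBound_le_norm_qPoch hb hq m
    have h3 := qPochBound_le_norm_qPoch hb hq r
    have h4 := norm_qPoch_le hb hq (m + r)
    rw [← h1] at h4
    have h5 : ‖gaussBinom q (m + r) m‖ * (qPochBound b * qPochBound b) ≤ (qPochBound b)⁻¹ :=
      le_trans (by gcongr) h4
    calc ‖gaussBinom q (m + r) m‖ = ‖gaussBinom q (m + r) m‖ * (qPochBound b * qPochBound b) *
          ((qPochBound b)⁻¹) ^ 2 := by field_simp
      _ ≤ (qPochBound b)⁻¹ * ((qPochBound b)⁻¹) ^ 2 := by gcongr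
      _ = _ := by ring

theorem exists_tendsto_qPoch {q : ℂ} (hq : ‖q‖ < 1) : ∃ P : ℂ, Tendsto (qPoch q) atTop (𝓝 P) := by
  have hs : Summable fun i : ℕ => ‖-q * q ^ i‖ := by
    simp only [norm_mul, norm_pow, norm_neg]
    exact (summable_geometric_of_lt_one (norm_nonneg _) hq).mul_left _
  have h := (multipliable_one_add_of_summable hs).hasProd.tendsto_prod_nat
  exact ⟨_, h.congr fun n => (qPoch_eq q n).symm⟩

/-- Dominated convergence: each coefficient tends to `P / (P * P)`, and all are bounded uniformly.
The index maps `a`, `c`, `r` let one statement serve both halves of the bilateral sum. -/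
theorem tendsto_sum_gaussBinom {q x P : ℂ} (hq : ‖q‖ < 1) (hP : Tendsto (qPoch q) atTop (𝓝 P))
    (hP0 : P ≠ 0) {a c : ℕ → ℕ → ℕ} {r : ℕ → ℕ}
    (hac : ∀ n, ∀ j < r n, a n j + c n j = n + n) (hr : ∀ j, ∀ᶠ n in atTop, j < r n)
    (ha : ∀ j, Tendsto (a · j) atTop atTop) (hc : ∀ j, Tendsto (c · j) atTop atTop) :
    Tendsto (fun n => ∑ j ∈ range (r n), gaussBinom q (n + n) (a n j) *
      (q ^ (j * (j + 1) / 2) * x ^ j)) atTop (𝓝 (P⁻¹ * partialTheta q x)) := by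
  have h1 : ∀ n, ∑ j ∈ range (r n), gaussBinom q (n + n) (a n j) * (q ^ (j * (j + 1) / 2) * x ^ j) =
      ∑' j, if j < r n then gaussBinom q (n + n) (a n j) * (q ^ (j * (j + 1) / 2) * x ^ j) else 0 := by
    intro n
    rw [tsum_eq_sum (s := range (r n))]
    · exact sum_congr rfl fun j hj => by rw [if_pos (mem_range.1 hj)]
    · intro j hj; rw [if_neg (by simpa using hj)]
  simp_rw [h1]
  rw [partialTheta, ← tsum_mul_left]
  have hs : Summable fun j : ℕ => (qPochBound ‖q‖)⁻¹ ^ 3 * ‖q ^ (j * (j + 1) / 2) * x ^ j‖ :=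
    (summable_partialTheta hq x).norm.mul_left _
  refine tendsto_tsum_of_dominated_convergence hs (fun j => ?_) (Eventually.of_forall fun n j => ?_)
  · have hG : Tendsto (fun n => gaussBinom q (n + n) (a n j)) atTop (𝓝 P⁻¹) := by
      have h2 : Tendsto (fun n => qPoch q (n + n) / (qPoch q (a n j) * qPoch q (c n j))) atTop
          (𝓝 (P / (P * P))) :=
        (hP.comp (tendsto_atTop_mono (fun n => Nat.le_add_left n n) tendsto_id)).div
          ((hP.comp (ha j)).mul (hP.comp (hc j))) (mul_ne_zero hP0 hP0)
      rw [show P / (P * P) = P⁻¹ by field_simp] at h2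
      refine h2.congr' ?_
      filter_upwards [hr j] with n hn
      have h3 := gaussBinom_mul_qPoch q (a n j) (c n j)
      have h4 : ∀ m, qPoch q m ≠ 0 := fun m => norm_pos_iff.1
        ((qPochBound_pos _).trans_le (qPochBound_le_norm_qPoch hq le_rfl m))
      rw [hac n j hn] at h3
      rw [← h3, mul_div_cancel_right₀ _ (mul_ne_zero (h4 _) (h4 _))]
    refine (hG.mul_const _).congr' ?_
    filter_upwards [hr j] with n hn
    rw [if_pos hn]
  · split_ifs
    · rw [norm_mul]
      exact mul_le_mul_of_nonneg_right (norm_gaussBinom_le hq le_rfl _ _) (norm_nonneg _)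
    · rw [norm_zero]
      have := qPochBound_pos ‖q‖
      positivity

/-- The Jacobi triple product identity, as a limit of finite products. -/
theorem tendsto_prod_fullTheta {q x P : ℂ} (hq : ‖q‖ < 1) (hq0 : q ≠ 0) (hx : x ≠ 0)
    (hP : Tendsto (qPoch q) atTop (𝓝 P)) (hP0 : P ≠ 0) :
    Tendsto (fun n => (∏ i ∈ range n, (1 + x * q ^ (i + 1))) * ∏ i ∈ range n, (1 + x⁻¹ * q ^ i))
      atTop (𝓝 (P⁻¹ * fullTheta q x)) := by
  simp_rw [prod_mul_prod_eq hq0 hx]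
  rw [fullTheta, mul_add, mul_left_comm]
  have hsub : ∀ j : ℕ, Tendsto (fun n : ℕ => n - j) atTop atTop := fun j => tendsto_sub_atTop_nat j
  have h1 := tendsto_sum_gaussBinom (x := x) (a := fun n j => n + j) (c := fun n j => n - j)
    (r := fun n => n + 1) hq hP hP0 (fun n j (hj : j < n + 1) => by omega)
    (fun j => (eventually_ge_atTop j).mono fun n hn => Nat.lt_succ_of_le hn)
    (fun j => tendsto_add_atTop_nat j) hsub
  have h2 := tendsto_sum_gaussBinom (x := x⁻¹) (a := fun n j => n - 1 - j)
    (c := fun n j => n + 1 + j) (r := fun n => n) hq hP hP0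
    (fun n j (hj : j < n) => by omega) (fun j => eventually_gt_atTop j)
    (fun j => (hsub (1 + j)).congr fun n => (Nat.sub_sub n 1 j).symm)
    (fun j => (tendsto_add_atTop_nat (1 + j)).congr fun n => (Nat.add_assoc n 1 j).symm)
  exact h1.add (h2.const_mul _)

/-- In the triple product only the factor `1 + x⁻¹` can be small in this range; each of the three
remaining products contributes one `qPochBound b`. -/
theorem le_norm_fullTheta {b : ℝ} (hb : b < 1) {q x : ℂ} (hq0 : q ≠ 0) (hx : x ≠ 0)
    (hq : ‖q‖ ≤ b) (hxq : ‖x * q‖ ≤ b) (hxq' : ‖x⁻¹ * q‖ ≤ b) :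
    qPochBound b ^ 3 * ‖1 + x⁻¹‖ ≤ ‖fullTheta q x‖ := by
  have hd := qPochBound_pos b
  obtain ⟨P, hP⟩ := exists_tendsto_qPoch (hq.trans_lt hb)
  have hPn : qPochBound b ≤ ‖P‖ := ge_of_tendsto' hP.norm fun n => qPochBound_le_norm_qPoch hb hq n
  have hP0 : P ≠ 0 := norm_pos_iff.1 (hd.trans_le hPn)
  have h := (tendsto_prod_fullTheta (hq.trans_lt hb) hq0 hx hP hP0).norm
  have h1 : qPochBound b * (qPochBound b * ‖1 + x⁻¹‖) ≤ ‖P⁻¹ * fullTheta q x‖ := by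
    refine ge_of_tendsto h ?_
    filter_upwards [eventually_ge_atTop 1] with n hn
    obtain ⟨n, rfl⟩ := Nat.exists_eq_add_of_le' hn
    rw [norm_mul, prod_range_succ' (fun i => 1 + x⁻¹ * q ^ i) n, norm_mul, pow_zero, mul_one]
    have e1 := qPochBound_le_norm_prod hb hq hxq (n + 1)
    have e2 := qPochBound_le_norm_prod hb hq hxq' n
    simp only [pow_succ', ← mul_assoc] at e1 e2 ⊢
    gcongr
  rw [norm_mul, norm_inv, ← div_eq_inv_mul, le_div_iff₀ (norm_pos_iff.2 hP0)] at h1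
  calc _ = qPochBound b * (qPochBound b * ‖1 + x⁻¹‖) * qPochBound b := by ring
    _ ≤ qPochBound b * (qPochBound b * ‖1 + x⁻¹‖) * ‖P‖ := by gcongr
    _ ≤ _ := h1

/-! ### Smallness of the bilateral series near `-1` -/

theorem Differentiable.exists_eq_prod_sub_mul {f : ℂ → ℂ} (hf : Differentiable ℂ f) (S : Finset ℂ)
    (hS : ∀ s ∈ S, f s = 0) :
    ∃ g : ℂ → ℂ, Differentiable ℂ g ∧ ∀ u, f u = (∏ s ∈ S, (u - s)) * g u := by
  induction S using Finset.induction_on generalizing f with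
  | empty => exact ⟨f, hf, by simp⟩
  | insert a S ha ih =>
    have h1 : Differentiable ℂ (dslope f a) := differentiableOn_univ.1
      ((Complex.differentiableOn_dslope univ_mem).2 hf.differentiableOn)
    have h0 : f a = 0 := hS a (mem_insert_self a S)
    obtain ⟨g, hg, hfg⟩ := ih h1 fun s hs => by
      rw [dslope_of_ne _ (ne_of_mem_of_not_mem hs ha), slope_def_field, h0, hS s (mem_insert_of_mem hs)]
      simp
    refine ⟨g, hg, fun u => ?_⟩
    have := sub_smul_dslope f a u
    rw [h0, sub_zero, smul_eq_mul, hfg] at this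
    rw [prod_insert ha, ← this, mul_assoc]

/-- An entire function with many zeros near the origin is small near the origin. -/
theorem Differentiable.norm_le_mul_pow_card {f : ℂ → ℂ} (hf : Differentiable ℂ f) (S : Finset ℂ)
    (hS : ∀ s ∈ S, f s = 0) {r R M : ℝ} (hr : 0 ≤ r) (hrR : r < R) (hSr : ∀ s ∈ S, ‖s‖ ≤ r)
    (hM : ∀ u, ‖u‖ ≤ R → ‖f u‖ ≤ M) {u : ℂ} (hu : ‖u‖ ≤ r) :
    ‖f u‖ ≤ M * (2 * r / (R - r)) ^ #S := by
  obtain ⟨g, hg, hfg⟩ := hf.exists_eq_prod_sub_mul S hS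
  have hRr : 0 < R - r := sub_pos.2 hrR
  have hM0 : 0 ≤ M := (norm_nonneg _).trans (hM 0 (by simpa using hr.trans hrR.le))
  have hgb : ‖g u‖ ≤ M / (R - r) ^ #S := by
    refine Complex.norm_le_of_forall_mem_frontier_norm_le (U := Metric.ball 0 R)
      Metric.isBounded_ball hg.diffContOnCl (fun z hz => ?_)
      (subset_closure (mem_ball_zero_iff.2 (hu.trans_lt hrR)))
    rw [frontier_ball _ (by linarith), mem_sphere_zero_iff_norm] at hz
    rw [le_div_iff₀ (by positivity)]
    have h1 : (R - r) ^ #S ≤ ‖∏ s ∈ S, (z - s)‖ := by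
      rw [norm_prod, ← prod_const]
      refine prod_le_prod (fun _ _ => hRr.le) fun s hs => ?_
      have := norm_sub_norm_le z s
      linarith [hSr s hs]
    calc ‖g z‖ * (R - r) ^ #S ≤ ‖g z‖ * ‖∏ s ∈ S, (z - s)‖ := by gcongr
      _ = ‖f z‖ := by rw [hfg z, norm_mul, mul_comm]
      _ ≤ M := hM z hz.le
  have h2 : ‖∏ s ∈ S, (u - s)‖ ≤ (2 * r) ^ #S := by
    rw [norm_prod, ← prod_const]
    refine prod_le_prod (fun _ _ => norm_nonneg _) fun s hs => ?_
    have := norm_sub_le u s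
    linarith [hSr s hs]
  rw [hfg, norm_mul, div_pow]
  calc _ ≤ (2 * r) ^ #S * (M / (R - r) ^ #S) := by gcongr
    _ = _ := by ring

/-- Completing the square gives `R j ≤ R² / t + t j² / 4`, which leaves a geometric series of ratio
`exp (-t / 2)`. -/
theorem norm_partialTheta_le_exp {q x : ℂ} {t R : ℝ} (ht : 0 < t) (hq : ‖q‖ = Real.exp (-t))
    (hx : ‖x‖ ≤ Real.exp R) :
    ‖partialTheta q x‖ ≤ (1 + 2 / t) * Real.exp (R ^ 2 / t) := by
  have ha : Real.exp (-(t / 2)) < 1 := by rw [Real.exp_lt_one_iff]; linarith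
  have hs := (hasSum_geometric_of_lt_one (Real.exp_pos (-(t / 2))).le ha).mul_left
    (Real.exp (R ^ 2 / t))
  refine (tsum_of_norm_bounded hs fun j => ?_).trans ?_
  · rw [norm_mul, norm_pow, norm_pow, hq, ← Real.exp_nat_mul, ← Real.exp_nat_mul, ← Real.exp_add]
    calc _ ≤ Real.exp (((j * (j + 1) / 2 : ℕ) : ℝ) * -t) * Real.exp R ^ j := by gcongr
      _ = Real.exp (((j * (j + 1) / 2 : ℕ) : ℝ) * -t + j * R) := by
        rw [← Real.exp_nat_mul, ← Real.exp_add]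
      _ ≤ _ := by
        rw [Real.exp_le_exp, triangle_cast]
        have h1 : (0 : ℝ) ≤ (R - t * j / 2) ^ 2 / t := by positivity
        have h2 : (R - t * j / 2) ^ 2 / t = R ^ 2 / t - R * j + t * j ^ 2 / 4 := by
          field_simp; ring
        nlinarith [mul_nonneg ht.le (sq_nonneg (j : ℝ))]
  · rw [mul_comm]
    refine mul_le_mul_of_nonneg_right ?_ (Real.exp_pos _).le
    have h3 : Real.exp (-(t / 2)) ≤ (1 + t / 2)⁻¹ := by
      rw [Real.exp_neg]
      exact inv_anti₀ (by positivity) (by linarith [Real.add_one_le_exp (t / 2)])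
    have h4 : 1 - (1 + t / 2)⁻¹ = (t / 2) / (1 + t / 2) := by field_simp; ring
    calc (1 - Real.exp (-(t / 2)))⁻¹ ≤ ((t / 2) / (1 + t / 2))⁻¹ := by
          rw [← h4]; exact inv_anti₀ (by rw [h4]; positivity) (by linarith)
      _ = _ := by field_simp; ring

theorem norm_fullTheta_neg_exp_le {q u : ℂ} {t R : ℝ} (ht : 0 < t) (hq : ‖q‖ = Real.exp (-t))
    (hu : ‖u‖ ≤ R) :
    ‖fullTheta q (-Complex.exp u)‖ ≤ (1 + Real.exp R) * ((1 + 2 / t) * Real.exp (R ^ 2 / t)) := by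
  have h1 : ∀ v : ℂ, ‖v‖ ≤ R → ‖-Complex.exp v‖ ≤ Real.exp R := fun v hv => by
    rw [norm_neg, Complex.norm_exp, Real.exp_le_exp]
    exact (Complex.re_le_norm v).trans hv
  have h2 : (-Complex.exp u)⁻¹ = -Complex.exp (-u) := by rw [Complex.exp_neg, inv_neg]
  have h3 := h1 (-u) (by simpa using hu)
  rw [fullTheta, h2]
  calc _ ≤ ‖partialTheta q (-Complex.exp u)‖ +
        ‖-Complex.exp (-u)‖ * ‖partialTheta q (-Complex.exp (-u))‖ := by
        rw [← norm_mul]; exact norm_add_le _ _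
    _ ≤ (1 + 2 / t) * Real.exp (R ^ 2 / t) +
        Real.exp R * ((1 + 2 / t) * Real.exp (R ^ 2 / t)) := by
        have e1 := norm_partialTheta_le_exp ht hq (h1 u hu)
        have e2 := norm_partialTheta_le_exp ht hq h3
        gcongr
    _ = _ := by ring

theorem norm_mul_exp_neg {w : ℂ} (hw : ‖w‖ = 1) (z : ℂ) :
    ‖w * Complex.exp (-z)‖ = Real.exp (-z.re) := by
  rw [norm_mul, hw, one_mul, Complex.norm_exp, Complex.neg_re]

/-- Exponential decay of the bilateral theta series near its zero `-1` as `q` tends radially to a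
root of unity. -/
theorem norm_fullTheta_neg_exp_le_decay {w u : ℂ} {n : ℕ} (hn : 0 < n) (hw : w ^ n = 1) {t R : ℝ}
    (ht : 0 < t) (hR : R = Real.log 2 / (16 * n)) (hu : ‖u‖ ≤ R / 8) :
    ‖fullTheta (w * Complex.exp (-t)) (-Complex.exp u)‖ ≤
      (1 + Real.exp R) * (1 + 2 / t) * Real.exp (-(R ^ 2 / t)) := by
  have hw1 : ‖w‖ = 1 := Complex.norm_eq_one_of_pow_eq_one hw hn.ne'
  have hn' : (0 : ℝ) < n := Nat.cast_pos.2 hn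
  have hR0 : 0 < R := by rw [hR]; have := Real.log_pos one_lt_two; positivity
  set q := w * Complex.exp (-t) with hq
  have hqn : ‖q‖ = Real.exp (-t) := by rw [hq, norm_mul_exp_neg hw1]; simp
  have hq1 : ‖q‖ < 1 := by rw [hqn, Real.exp_lt_one_iff]; linarith
  have hq0 : q ≠ 0 := norm_pos_iff.1 (by rw [hqn]; exact Real.exp_pos _)
  let f : ℂ → ℂ := fun u => fullTheta q (-Complex.exp u)
  have hf : Differentiable ℂ f := by
    have e : ∀ u : ℂ, (-Complex.exp u)⁻¹ = -Complex.exp (-u) := fun u => by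
      rw [Complex.exp_neg, inv_neg]
    have : f = fun u => partialTheta q (-Complex.exp u) +
        -Complex.exp (-u) * partialTheta q (-Complex.exp (-u)) := by
      funext u; simp only [f, fullTheta, e]
    rw [this]
    have := differentiable_partialTheta hq1
    fun_prop
  -- As `w ^ n = 1`, the zeros `-q^{-nj}` are `-exp (n t j)`: in the variable `u` they have spacing
  -- `n t`, and `J + 1` of them lie in `[0, R / 8]`.
  let J := ⌊R / 8 / (n * t)⌋₊
  let S : Finset ℂ := (range (J + 1)).image fun j : ℕ => ((n * t * j : ℝ) : ℂ)
  have hnt : 0 < n * t := by positivity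
  have hcard : #S = J + 1 := by
    rw [card_image_of_injective, card_range]
    intro a b hab
    have h1 : (n * t * a : ℝ) = n * t * b := by dsimp only at hab; exact_mod_cast hab
    exact_mod_cast mul_left_cancel₀ hnt.ne' h1
  have hS0 : ∀ s ∈ S, f s = 0 := by
    intro s hs
    obtain ⟨j, -, rfl⟩ := mem_image.1 hs
    have h1 : q ^ (n * j) = Complex.exp (-(n * t * j : ℝ)) := by
      rw [hq, mul_pow, pow_mul, hw, one_pow, one_mul, ← Complex.exp_nat_mul]
      congr 1; push_cast; ring
    have h2 : -Complex.exp ((n * t * j : ℝ) : ℂ) = -1 / q ^ (n * j) := by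
      rw [h1, Complex.exp_neg]; simp
    simp only [f]
    rw [h2, fullTheta_neg_inv_pow hq1 hq0]
  have hSr : ∀ s ∈ S, ‖s‖ ≤ R / 8 := by
    intro s hs
    obtain ⟨j, hj, rfl⟩ := mem_image.1 hs
    rw [Complex.norm_real, Real.norm_of_nonneg (by positivity)]
    have h1 : (j : ℝ) ≤ R / 8 / (n * t) := by
      have h2 : (j : ℝ) ≤ J := by exact_mod_cast Nat.lt_succ_iff.1 (mem_range.1 hj)
      exact h2.trans (Nat.floor_le (by positivity))
    rw [le_div_iff₀ hnt] at h1
    linarith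
  have key := hf.norm_le_mul_pow_card S hS0 (by positivity) (by linarith : R / 8 < R) hSr
    (fun v hv => norm_fullTheta_neg_exp_le ht hqn hv) hu
  refine key.trans ?_
  rw [hcard]
  -- Each zero gains a factor 2/7, at most 1/2. The choice `log 2 = 16 n R` makes the total gain
  -- `exp (-2 R² / t)`, beating the growth `exp (R² / t)`.
  have h3 : (2 * (R / 8) / (R - R / 8)) ^ (J + 1) ≤ Real.exp (-(2 * (R ^ 2 / t))) := by
    have e1 : 2 * (R / 8) / (R - R / 8) ≤ 1 / 2 := by
      rw [div_le_iff₀ (by linarith)]; linarith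
    have e2 : (1 / 2 : ℝ) = Real.exp (-Real.log 2) := by
      rw [Real.exp_neg, Real.exp_log two_pos]; norm_num
    calc _ ≤ (1 / 2 : ℝ) ^ (J + 1) := by
          refine pow_le_pow_left₀ (div_nonneg (by linarith) (by linarith)) e1 _
      _ = Real.exp (-((J + 1 : ℕ) * Real.log 2)) := by
          rw [e2, ← Real.exp_nat_mul]; congr 1; ring
      _ ≤ _ := by
          rw [Real.exp_le_exp, neg_le_neg_iff]
          have e3 : R / 8 / (n * t) ≤ (J + 1 : ℕ) := by
            push_cast; exact (Nat.lt_floor_add_one _).le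
          have e4 : 2 * (R ^ 2 / t) = R / 8 / (n * t) * Real.log 2 := by
            have : Real.log 2 = R * (16 * n) := by rw [hR]; field_simp
            rw [this]; field_simp; ring
          rw [e4]
          exact mul_le_mul_of_nonneg_right e3 (Real.log_pos one_lt_two).le
  calc _ ≤ (1 + Real.exp R) * ((1 + 2 / t) * Real.exp (R ^ 2 / t)) *
        Real.exp (-(2 * (R ^ 2 / t))) := by gcongr
    _ = (1 + Real.exp R) * (1 + 2 / t) * (Real.exp (R ^ 2 / t) * Real.exp (-(2 * (R ^ 2 / t)))) := by
        ring
    _ = _ := by rw [← Real.exp_add]; congr 2; ring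

/-! ### Roots near `-q^{-(j+1)}` -/

/-- Quasi-periodicity moves the point to the annulus where the product bound applies. The worst case
`‖y‖ = exp (-t / 2)` gives the exponent `j² - 1`; using `δ ≤ t` keeps the constant uniform in `t`.
-/
theorem le_norm_fullTheta_neg_div_pow {q y : ℂ} {t δ : ℝ} (hδ : 0 < δ) (hδt : δ ≤ t)
    (hq : ‖q‖ = Real.exp (-t)) (hy1 : Real.exp (-(t / 2)) ≤ ‖y‖) (hy2 : ‖y‖ ≤ Real.exp (t / 2))
    (j : ℕ) :
    Real.exp (t * ((j : ℝ) ^ 2 - 1) / 2) * (qPochBound (Real.exp (-(δ / 2))) ^ 3 * ‖y⁻¹ - 1‖) ≤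
      ‖fullTheta q (-y / q ^ (j + 1))‖ := by
  have hq1 : ‖q‖ < 1 := by rw [hq, Real.exp_lt_one_iff]; linarith
  have hq0 : q ≠ 0 := norm_pos_iff.1 (by rw [hq]; exact Real.exp_pos _)
  have hy0 : y ≠ 0 := norm_pos_iff.1 ((Real.exp_pos _).trans_le hy1)
  have hb : Real.exp (-(δ / 2)) < 1 := by rw [Real.exp_lt_one_iff]; linarith
  have hbt : Real.exp (-(t / 2)) ≤ Real.exp (-(δ / 2)) := by rw [Real.exp_le_exp]; linarith
  have hqt : ‖q‖ = Real.exp (-(t / 2)) * Real.exp (-(t / 2)) := by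
    rw [hq, ← Real.exp_add]; ring_nf
  have hee : Real.exp (t / 2) * Real.exp (-(t / 2)) = 1 := by rw [← Real.exp_add]; simp
  have he1 : Real.exp (-(t / 2)) ≤ 1 := hbt.trans hb.le
  have hpos := Real.exp_pos (-(t / 2))
  have h1 : ‖-y * q‖ ≤ Real.exp (-(δ / 2)) := by
    refine le_trans ?_ hbt
    rw [norm_mul, norm_neg, hqt]
    calc _ ≤ Real.exp (t / 2) * (Real.exp (-(t / 2)) * Real.exp (-(t / 2))) := by gcongr
      _ = _ := by rw [← mul_assoc, hee, one_mul]
  have h2 : ‖(-y)⁻¹ * q‖ ≤ Real.exp (-(δ / 2)) := by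
    refine le_trans ?_ hbt
    rw [norm_mul, norm_inv, norm_neg, hqt, inv_mul_le_iff₀ (norm_pos_iff.2 hy0)]
    gcongr
  have h3 := le_norm_fullTheta hb hq0 (neg_ne_zero.2 hy0)
    (by rw [hqt]; nlinarith) h1 h2
  rw [norm_fullTheta_div_pow hq1 hq0 (neg_ne_zero.2 hy0), norm_neg]
  have h4 : ‖1 + (-y)⁻¹‖ = ‖y⁻¹ - 1‖ := by
    rw [← norm_neg, inv_neg]; congr 1; ring
  rw [h4] at h3
  refine mul_le_mul ?_ h3 (by have := qPochBound_pos (Real.exp (-(δ / 2))); positivity)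
    (by positivity)
  rw [hq, ← Real.exp_nat_mul, div_eq_mul_inv (‖y‖ ^ _), ← Real.exp_neg]
  calc Real.exp (t * ((j : ℝ) ^ 2 - 1) / 2)
      = Real.exp (-(t / 2)) ^ (j + 1) * Real.exp (-(((j * (j + 1) / 2 : ℕ) : ℝ) * -t)) := by
        rw [← Real.exp_nat_mul, ← Real.exp_add, triangle_cast]
        congr 1; push_cast; ring
    _ ≤ _ := by gcongr

theorem norm_neg_div_pow {q y : ℂ} {t : ℝ} (hq : ‖q‖ = Real.exp (-t)) (k : ℕ) :
    ‖-y / q ^ k‖ = ‖y‖ * Real.exp (t * k) := by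
  rw [norm_div, norm_neg, norm_pow, hq, ← Real.exp_nat_mul, div_eq_mul_inv, ← Real.exp_neg]
  congr 2; ring

/-- The radius of the annulus in which roots near `-q^{-(j+1)}` are controlled by `‖q‖ = exp (-ρ)`. -/
noncomputable def rootError (ρ : ℝ) (j : ℕ) : ℝ :=
  (Real.exp (ρ * ((j : ℝ) ^ 2 - 1) / 2) * qPochBound (Real.exp (-(ρ / 2))) ^ 3)⁻¹

theorem rootError_pos (ρ : ℝ) (j : ℕ) : 0 < rootError ρ j := by
  have := qPochBound_pos (Real.exp (-(ρ / 2)))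
  unfold rootError; positivity

theorem two_le_norm_neg_div_pow {q y : ℂ} {ρ : ℝ} (hq : ‖q‖ = Real.exp (-ρ))
    (hy1 : Real.exp (-(ρ / 2)) ≤ ‖y‖) {j : ℕ} (hj : 2 ≤ Real.exp (ρ * (j + 1 / 2))) :
    2 ≤ ‖-y / q ^ (j + 1)‖ := by
  rw [norm_neg_div_pow hq]
  calc 2 ≤ Real.exp (ρ * (j + 1 / 2)) := hj
    _ = Real.exp (-(ρ / 2)) * Real.exp (ρ * (j + 1 : ℕ)) := by
      rw [← Real.exp_add]; congr 1; push_cast; ring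
    _ ≤ _ := by gcongr

theorem norm_inv_sub_one_le_rootError {q y : ℂ} {ρ : ℝ} (hρ : 0 < ρ) (hq : ‖q‖ = Real.exp (-ρ))
    (hy1 : Real.exp (-(ρ / 2)) ≤ ‖y‖) (hy2 : ‖y‖ ≤ Real.exp (ρ / 2)) {j : ℕ}
    (hj : 2 ≤ Real.exp (ρ * (j + 1 / 2))) (h : partialTheta q (-y / q ^ (j + 1)) = 0) :
    ‖y⁻¹ - 1‖ ≤ rootError ρ j := by
  have h1 := le_norm_fullTheta_neg_div_pow hρ le_rfl hq hy1 hy2 j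
  have hq1 : ‖q‖ < 1 := by rw [hq, Real.exp_lt_one_iff]; linarith
  have h2 := norm_inv_mul_partialTheta_inv_le hq1.le (two_le_norm_neg_div_pow hq hy1 hj)
  rw [partialTheta_eq_fullTheta_sub, sub_eq_zero] at h
  rw [← h] at h2
  have hd := qPochBound_pos (Real.exp (-(ρ / 2)))
  rw [rootError, ← one_div (_ * _), le_div_iff₀ (by positivity)]
  linarith

/-- A Rouché argument through the maximum principle: without a root, `1 / Ψ` is holomorphic on the
disk and at most 1/2 on its boundary, yet at the centre the bilateral series vanishes and `‖Ψ 1‖ ≤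
1`. -/
theorem exists_root_of_rootError_le {q : ℂ} {ρ : ℝ} (hρ : 0 < ρ) (hq : ‖q‖ = Real.exp (-ρ))
    {j : ℕ} (hj : 2 ≤ Real.exp (ρ * (j + 1 / 2)))
    (hj' : 3 * rootError ρ j ≤ (1 - Real.exp (-(ρ / 2))) * Real.exp (-(ρ / 2))) :
    ∃ y : ℂ, Real.exp (-(ρ / 2)) ≤ ‖y‖ ∧ ‖y‖ ≤ Real.exp (ρ / 2) ∧
      partialTheta q (-y / q ^ (j + 1)) = 0 := by
  have hq1 : ‖q‖ < 1 := by rw [hq, Real.exp_lt_one_iff]; linarith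
  have hq0 : q ≠ 0 := norm_pos_iff.1 (by rw [hq]; exact Real.exp_pos _)
  set r := 1 - Real.exp (-(ρ / 2)) with hr
  have hr0 : 0 < r := by rw [hr, sub_pos, Real.exp_lt_one_iff]; linarith
  have hr2 : 1 + r ≤ Real.exp (ρ / 2) := by
    have h1 := Real.add_one_le_exp (ρ / 2)
    have h2 := Real.add_one_le_exp (-(ρ / 2))
    linarith
  have hann : ∀ y ∈ Metric.closedBall (1 : ℂ) r,
      Real.exp (-(ρ / 2)) ≤ ‖y‖ ∧ ‖y‖ ≤ Real.exp (ρ / 2) := by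
    intro y hy
    rw [mem_closedBall_iff_norm] at hy
    have h1 := norm_sub_norm_le 1 y
    have h2 := norm_sub_norm_le y 1
    rw [norm_sub_rev, norm_one] at h1
    rw [norm_one] at h2
    constructor <;> linarith
  by_contra! hne
  let Ψ : ℂ → ℂ := fun y => partialTheta q (-y / q ^ (j + 1))
  have hΨ : Differentiable ℂ Ψ := by
    have := differentiable_partialTheta hq1
    fun_prop
  have hΨ0 : ∀ y ∈ Metric.closedBall (1 : ℂ) r, Ψ y ≠ 0 := fun y hy =>
    hne y (hann y hy).1 (hann y hy).2
  have hΨT : ∀ y, Real.exp (-(ρ / 2)) ≤ ‖y‖ →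
      ‖Ψ y - fullTheta q (-y / q ^ (j + 1))‖ ≤ 1 := by
    intro y hy
    have := norm_inv_mul_partialTheta_inv_le hq1.le (two_le_norm_neg_div_pow hq hy hj)
    simp only [Ψ]
    rwa [partialTheta_eq_fullTheta_sub, sub_sub_cancel_left, norm_neg]
  have h1 : ‖Ψ 1‖ ≤ 1 := by
    have := hΨT 1 (by simp; linarith)
    rwa [fullTheta_neg_inv_pow hq1 hq0, sub_zero] at this
  have hsph : ∀ y ∈ frontier (Metric.ball (1 : ℂ) r), ‖(Ψ y)⁻¹‖ ≤ 1 / 2 := by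
    intro y hy
    rw [frontier_ball _ hr0.ne', mem_sphere_iff_norm] at hy
    obtain ⟨ha, hb⟩ := hann y (by rw [mem_closedBall_iff_norm]; exact hy.le)
    have hy0 : y ≠ 0 := norm_pos_iff.1 ((Real.exp_pos _).trans_le ha)
    have e1 := le_norm_fullTheta_neg_div_pow hρ le_rfl hq ha hb j
    have e2 : r * Real.exp (-(ρ / 2)) ≤ ‖y⁻¹ - 1‖ := by
      have : y⁻¹ - 1 = -((y - 1) * y⁻¹) := by field_simp; ring
      rw [this, norm_neg, norm_mul, hy, norm_inv, Real.exp_neg]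
      gcongr
    have e3 : 3 ≤ ‖fullTheta q (-y / q ^ (j + 1))‖ := by
      refine le_trans ?_ e1
      have hd := qPochBound_pos (Real.exp (-(ρ / 2)))
      have h5 := hj'.trans e2
      rw [rootError, ← div_eq_mul_inv, div_le_iff₀ (by positivity)] at h5
      linarith
    have e4 := hΨT y ha
    have e5 := norm_sub_norm_le (fullTheta q (-y / q ^ (j + 1))) (Ψ y)
    rw [norm_sub_rev] at e5
    rw [norm_inv, inv_le_comm₀ (by linarith) (by norm_num)]
    linarith
  have hinv : DiffContOnCl ℂ (fun y => (Ψ y)⁻¹) (Metric.ball 1 r) := by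
    refine DifferentiableOn.diffContOnCl fun y hy => ?_
    rw [closure_ball _ hr0.ne'] at hy
    exact (hΨ.differentiableAt.inv (hΨ0 y hy)).differentiableWithinAt
  have h2 := Complex.norm_le_of_forall_mem_frontier_norm_le Metric.isBounded_ball hinv hsph
    (subset_closure (Metric.mem_ball_self hr0))
  have h3 : 0 < ‖Ψ 1‖ := norm_pos_iff.2 (hΨ0 1 (Metric.mem_closedBall_self hr0.le))
  rw [norm_inv, inv_le_comm₀ h3 (by norm_num)] at h2
  linarith

/-! ### Continuation of roots in the logarithmic coordinate -/

/-- The absence of spectral values enters the argument only here, as simplicity of roots. -/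
theorem deriv_partialTheta_ne_zero {q x : ℂ} (hq : ‖q‖ < 1) (hs : q ∉ partialThetaSpec)
    (h : partialTheta q x = 0) : (∑' j, partialThetaTermFDeriv j (q, x)) (0, 1) ≠ 0 := by
  intro h0
  refine hs ⟨hq, x, h, ?_⟩
  rw [(hasDerivAt_partialTheta hq x).deriv, h0]

/-- A circle on which the partial theta function does not vanish. -/
theorem partialTheta_ne_zero_of_norm_eq {q x : ℂ} {t δ : ℝ} (hδ : 0 < δ) (hδt : δ ≤ t)
    (hq : ‖q‖ = Real.exp (-t)) {M : ℕ} (hM1 : 1 ≤ M) (hM2 : 2 ≤ Real.exp (δ * (M + 1 / 2)))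
    (hM : 2 * rootError δ M ≤ 1 - Real.exp (-(δ / 2)))
    (hx : ‖x‖ = Real.exp (t * (M + 3 / 2))) : partialTheta q x ≠ 0 := by
  intro h
  have ht : 0 < t := hδ.trans_le hδt
  have hq1 : ‖q‖ < 1 := by rw [hq, Real.exp_lt_one_iff]; linarith
  have hq0 : q ≠ 0 := norm_pos_iff.1 (by rw [hq]; exact Real.exp_pos _)
  have hx2 : 2 ≤ ‖x‖ := by
    rw [hx]
    refine hM2.trans (Real.exp_le_exp.2 ?_)
    gcongr; norm_num
  -- The circle passes midway, on the logarithmic scale, between the moduli of `-q^{-(M+1)}` and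
  -- `-q^{-(M+2)}`.
  set y := -x * q ^ (M + 1) with hy
  have hxy : x = -y / q ^ (M + 1) := by rw [hy]; field_simp
  have hyn : ‖y‖ = Real.exp (t / 2) := by
    rw [hy, norm_mul, norm_neg, norm_pow, hx, hq, ← Real.exp_nat_mul, ← Real.exp_add]
    congr 1; push_cast; ring
  have h1 := le_norm_fullTheta_neg_div_pow hδ hδt hq
    (by rw [hyn, Real.exp_le_exp]; linarith) hyn.le M
  rw [← hxy] at h1
  have h2 := norm_inv_mul_partialTheta_inv_le hq1.le hx2
  rw [partialTheta_eq_fullTheta_sub, sub_eq_zero] at h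
  rw [← h] at h2
  have h3 : 1 - Real.exp (-(δ / 2)) ≤ ‖y⁻¹ - 1‖ := by
    have e := norm_sub_norm_le 1 y⁻¹
    rw [norm_sub_rev, norm_one, norm_inv, hyn, ← Real.exp_neg] at e
    have : Real.exp (-(t / 2)) ≤ Real.exp (-(δ / 2)) := by rw [Real.exp_le_exp]; linarith
    linarith
  have hd := qPochBound_pos (Real.exp (-(δ / 2)))
  have h4 : 2 ≤ Real.exp (δ * ((M : ℝ) ^ 2 - 1) / 2) *
      qPochBound (Real.exp (-(δ / 2))) ^ 3 * ‖y⁻¹ - 1‖ := by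
    have := hM.trans h3
    rw [rootError, ← div_eq_mul_inv, div_le_iff₀ (by positivity)] at this
    linarith
  have h5 : Real.exp (δ * ((M : ℝ) ^ 2 - 1) / 2) ≤ Real.exp (t * ((M : ℝ) ^ 2 - 1) / 2) := by
    rw [Real.exp_le_exp]
    have : (1 : ℝ) ≤ M := by exact_mod_cast hM1
    have : 0 ≤ (M : ℝ) ^ 2 - 1 := by nlinarith
    gcongr
  have h6 : Real.exp (δ * ((M : ℝ) ^ 2 - 1) / 2) *
      (qPochBound (Real.exp (-(δ / 2))) ^ 3 * ‖y⁻¹ - 1‖) ≤ 1 :=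
    le_trans (mul_le_mul_of_nonneg_right h5 (by positivity)) (h1.trans h2)
  linarith

theorem tendsto_sq_sub_one_atTop : Tendsto (fun j : ℕ => (j : ℝ) ^ 2 - 1) atTop atTop :=
  tendsto_atTop_add_const_right _ _
    ((tendsto_pow_atTop two_ne_zero).comp tendsto_natCast_atTop_atTop)

theorem tendsto_rootError {ρ : ℝ} (hρ : 0 < ρ) : Tendsto (rootError ρ) atTop (𝓝 0) := by
  refine Tendsto.inv_tendsto_atTop ?_
  have hd := qPochBound_pos (Real.exp (-(ρ / 2)))
  refine Tendsto.atTop_mul_const (by positivity) (Real.tendsto_exp_atTop.comp ?_)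
  exact (tendsto_sq_sub_one_atTop.const_mul_atTop hρ).atTop_div_const two_pos

theorem eventually_two_le_exp {ρ : ℝ} (hρ : 0 < ρ) :
    ∀ᶠ j : ℕ in atTop, 2 ≤ Real.exp (ρ * (j + 1 / 2)) :=
  (Real.tendsto_exp_atTop.comp ((tendsto_atTop_add_const_right _ _
    tendsto_natCast_atTop_atTop).const_mul_atTop hρ)).eventually_ge_atTop 2

/-- Continuation of a root of the partial theta function over a rectangle in the logarithmic
coordinate `q = w exp (-z)` which contains no spectral value. -/
theorem exists_differentiableOn_root_partialTheta {w : ℂ} (hw : ‖w‖ = 1) {δ ρ : ℝ} (hδ : 0 < δ)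
    (hδρ : δ < ρ) (hspec : ∀ z ∈ Set.Ioo δ (2 * ρ) ×ℂ Set.Ioo (-(2 * ρ)) (2 * ρ),
      w * Complex.exp (-z) ∉ partialThetaSpec) {x₀ : ℂ}
    (h₀ : partialTheta (w * Complex.exp (-ρ)) x₀ = 0) :
    ∃ ξ : ℂ → ℂ, DifferentiableOn ℂ ξ (Set.Ioo δ (2 * ρ) ×ℂ Set.Ioo (-(2 * ρ)) (2 * ρ)) ∧
      ξ ρ = x₀ ∧ ∀ z ∈ Set.Ioo δ (2 * ρ) ×ℂ Set.Ioo (-(2 * ρ)) (2 * ρ),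
        partialTheta (w * Complex.exp (-z)) (ξ z) = 0 := by
  have hρ : 0 < ρ := hδ.trans hδρ
  have he : Real.exp (-(δ / 2)) < 1 := by rw [Real.exp_lt_one_iff]; linarith
  have hR0 : Tendsto (fun M : ℕ => ρ * ((M : ℝ) + 3 / 2)) atTop atTop :=
    (tendsto_atTop_add_const_right _ _ tendsto_natCast_atTop_atTop).const_mul_atTop hρ
  -- One `M` serves all `Re z ≥ δ` and makes the circle over `ρ` enclose `x₀`.
  obtain ⟨M, hM1, hM2, hM3, hM4⟩ := ((eventually_ge_atTop 1).and
    ((eventually_two_le_exp hδ).and ((((tendsto_rootError hδ).const_mul 2).eventually_le_const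
      (v := 2 * 0) (u := 1 - Real.exp (-(δ / 2))) (by linarith)).and
    ((Real.tendsto_exp_atTop.comp hR0).eventually_ge_atTop ‖x₀‖)))).exists
  let D : ℂ → ℂ × ℂ →L[ℂ] ℂ × ℂ := fun z =>
    ((w * (Complex.exp (-z) * -1)) • ContinuousLinearMap.fst ℂ ℂ ℂ).prod (.snd ℂ ℂ ℂ)
  have hD : ∀ p : ℂ × ℂ, HasStrictFDerivAt (fun p : ℂ × ℂ => (w * Complex.exp (-p.1), p.2))
      (D p.1) p := by
    intro p
    have h1 : HasStrictDerivAt (fun z => w * Complex.exp (-z)) (w * (Complex.exp (-p.1) * -1)) p.1 :=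
      (((hasStrictDerivAt_id p.1).neg).cexp).const_mul w
    exact (h1.comp_hasStrictFDerivAt p hasStrictFDerivAt_fst).prodMk hasStrictFDerivAt_snd
  have hnorm : ∀ z : ℂ, 0 < z.re → ‖w * Complex.exp (-z)‖ < 1 := fun z hz => by
    rw [norm_mul_exp_neg hw, Real.exp_lt_one_iff]; linarith
  refine exists_differentiableOn_root
    (F := fun p => partialTheta (w * Complex.exp (-p.1)) p.2)
    (F' := fun p => (∑' j, partialThetaTermFDeriv j (w * Complex.exp (-p.1), p.2)) ∘L D p.1)
    (K := Set.Icc δ (2 * ρ) ×ℂ Set.Icc (-(2 * ρ)) (2 * ρ))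
    (R := fun z => Real.exp (z.re * (M + 3 / 2)))
    (isOpen_Ioo.reProdIm isOpen_Ioo) ?_ (isCompact_Icc.reProdIm isCompact_Icc)
    ?_ (by fun_prop) ?_ ?_ ?_ ?_ ?_ h₀
  · exact ((convex_Ioo _ _).linear_preimage Complex.reLm).inter
      ((convex_Ioo _ _).linear_preimage Complex.imLm)
  · exact fun z hz => ⟨Set.Ioo_subset_Icc_self hz.1, Set.Ioo_subset_Icc_self hz.2⟩
  · intro z hz x
    exact (hasStrictFDerivAt_partialTheta (p := (w * Complex.exp (-z), x))
      (hnorm z (hδ.trans_le hz.1.1))).comp (z, x) (hD (z, x))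
  · intro z hz x h
    have := deriv_partialTheta_ne_zero (hnorm z (hδ.trans hz.1.1)) (hspec z hz) h
    simpa [D] using this
  · intro z hz x hx
    exact partialTheta_ne_zero_of_norm_eq hδ hz.1.1.le (norm_mul_exp_neg hw z) hM1 hM2
      (by simpa using hM3) hx
  · refine ⟨⟨?_, ?_⟩, ?_, ?_⟩ <;> simp <;> linarith
  · simpa using hM4

/-! ### Propagating the smallness of the root error -/

/-- Along a continuous family over an interval, a quantity that avoids the gap `(ε, r]` and starts
below `ε` stays below `ε`. -/
theorem le_of_gap {h : ℝ → ℝ} {a : ℝ} (hc : ContinuousOn h (Set.Ioo (-a) a)) {ε r : ℝ}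
    (hεr : ε < r) (hgap : ∀ x ∈ Set.Ioo (-a) a, h x ≤ r → h x ≤ ε) (ha : 0 < a) (h0 : h 0 ≤ ε)
    {x : ℝ} (hx : x ∈ Set.Ioo (-a) a) : h x ≤ ε := by
  by_contra! hlt
  have hr : r < h x := by
    by_contra! hle
    exact absurd (hgap x hx hle) (not_le.2 hlt)
  have h0m : (0 : ℝ) ∈ Set.Ioo (-a) a := ⟨by linarith, ha⟩
  obtain ⟨y, hy, hyr⟩ := (isPreconnected_Ioo.image h hc).ordConnected.out
    ⟨0, h0m, rfl⟩ ⟨x, hx, rfl⟩ (⟨h0.trans hεr.le, hr.le⟩ : r ∈ Set.Icc (h 0) (h x))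
  have := hgap y hy hyr.le
  linarith

/-- A two-constants estimate on a rectangle: a function of exponential growth `exp (k Re z)` which is
tiny on the far edge is exponentially small at points of the real axis. -/
theorem norm_le_of_small_on_edge {f : ℂ → ℂ} {δ ρ κ a : ℝ} (hδ : 0 < δ) (hδρ : δ < ρ) (hκ : 0 ≤ κ)
    (ha : 0 ≤ a) (hf : DifferentiableOn ℂ f (Set.Icc δ ρ ×ℂ Set.Icc (-ρ) ρ))
    (hgrow : ∀ z ∈ Set.Icc δ ρ ×ℂ Set.Icc (-ρ) ρ, ‖f z‖ ≤ 3 * Real.exp (κ * z.re))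
    (hedge : ∀ y ∈ Set.Icc (-ρ) ρ, ‖f (ρ + y * Complex.I)‖ ≤ Real.exp (-(3 / 2 * a * ρ)))
    (haδ : 3 / 2 * a * δ ≤ 1) {t : ℝ} (ht : t ∈ Set.Icc δ ρ) :
    ‖f t‖ ≤ 3 * Real.exp 1 * Real.exp (κ * t - a * t) := by
  have hρ : 0 < ρ := hδ.trans hδρ
  let U : Set ℂ := Set.Ioo δ ρ ×ℂ Set.Ioo (-ρ) ρ
  have hcl : closure U = Set.Icc δ ρ ×ℂ Set.Icc (-ρ) ρ := by
    rw [Complex.closure_reProdIm, closure_Ioo hδρ.ne, closure_Ioo (by linarith)]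
  -- The real part of `z + z³ / (2ρ²)` is nonpositive on the horizontal sides, at most `3/2 Re z` on
  -- the vertical ones, and at least `z` on the positive real axis.
  let g : ℂ → ℂ := fun z =>
    f z * Complex.exp (-(κ * z) + a * (z + z ^ 3 / (2 * ρ ^ 2)))
  have hre : ∀ z : ℂ, (-(κ * z) + a * (z + z ^ 3 / (2 * ρ ^ 2)) : ℂ).re =
      -(κ * z.re) + a * (z.re * (1 + (z.re ^ 2 - 3 * z.im ^ 2) / (2 * ρ ^ 2))) := by
    intro z
    have h1 : (z ^ 3 / (2 * ρ ^ 2) : ℂ) = ((1 / (2 * ρ ^ 2) : ℝ) : ℂ) * z ^ 3 := by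
      push_cast; ring
    have h2 : (z ^ 3).re = z.re ^ 3 - 3 * z.re * z.im ^ 2 := by
      simp [pow_succ]; ring
    rw [h1, Complex.add_re, Complex.neg_re, Complex.re_ofReal_mul, Complex.re_ofReal_mul,
      Complex.add_re, Complex.re_ofReal_mul, h2]
    field_simp
  have hg : ∀ z, ‖g z‖ = ‖f z‖ * Real.exp (-(κ * z.re) +
      a * (z.re * (1 + (z.re ^ 2 - 3 * z.im ^ 2) / (2 * ρ ^ 2)))) := fun z => by
    rw [norm_mul, Complex.norm_exp, hre]
  have hgd : DiffContOnCl ℂ g U := by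
    refine DifferentiableOn.diffContOnCl ?_
    rw [hcl]
    refine hf.mul (Differentiable.differentiableOn ?_)
    fun_prop
  have he1 : (1 : ℝ) ≤ Real.exp 1 := Real.one_le_exp zero_le_one
  have hquot : ∀ x y : ℝ, x ∈ Set.Icc δ ρ → 1 + (x ^ 2 - 3 * y ^ 2) / (2 * ρ ^ 2) ≤ 3 / 2 := by
    intro x y hx
    have : (x ^ 2 - 3 * y ^ 2) / (2 * ρ ^ 2) ≤ 1 / 2 := by
      rw [div_le_iff₀ (by positivity)]
      have := pow_le_pow_left₀ (hδ.le.trans hx.1) hx.2 2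
      nlinarith [sq_nonneg y]
    linarith
  have hgen : ∀ z ∈ Set.Icc δ ρ ×ℂ Set.Icc (-ρ) ρ,
      z.re * (1 + (z.re ^ 2 - 3 * z.im ^ 2) / (2 * ρ ^ 2)) ≤ 3 / 2 * δ →
      ‖g z‖ ≤ 3 * Real.exp 1 := by
    intro z hz h
    rw [hg]
    calc _ ≤ 3 * Real.exp (κ * z.re) * Real.exp (-(κ * z.re) +
          a * (z.re * (1 + (z.re ^ 2 - 3 * z.im ^ 2) / (2 * ρ ^ 2)))) := by
          gcongr; exact hgrow z hz
      _ = 3 * Real.exp (a * (z.re * (1 + (z.re ^ 2 - 3 * z.im ^ 2) / (2 * ρ ^ 2)))) := by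
          rw [mul_assoc, ← Real.exp_add]; congr 2; ring
      _ ≤ _ := by
          gcongr
          nlinarith [mul_le_mul_of_nonneg_left h ha]
  have hfr : ∀ z ∈ frontier U, ‖g z‖ ≤ 3 * Real.exp 1 := by
    intro z hz
    have hzc : z ∈ Set.Icc δ ρ ×ℂ Set.Icc (-ρ) ρ := hcl ▸ frontier_subset_closure hz
    have hx0 : 0 < z.re := hδ.trans_le hzc.1.1
    rw [(isOpen_Ioo.reProdIm isOpen_Ioo).frontier_eq] at hz
    by_cases h1 : z.re = ρ
    · have h2 : z = ρ + z.im * Complex.I := by rw [← h1]; exact (Complex.re_add_im z).symm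
      rw [hg, h1]
      have h3 := hedge z.im hzc.2
      rw [← h2] at h3
      calc _ ≤ Real.exp (-(3 / 2 * a * ρ)) * Real.exp (-(κ * ρ) +
            a * (ρ * (1 + (ρ ^ 2 - 3 * z.im ^ 2) / (2 * ρ ^ 2)))) := by gcongr
        _ = Real.exp (-(3 / 2 * a * ρ) + (-(κ * ρ) +
            a * (ρ * (1 + (ρ ^ 2 - 3 * z.im ^ 2) / (2 * ρ ^ 2))))) := (Real.exp_add _ _).symm
        _ ≤ 1 := by
            rw [Real.exp_le_one_iff]
            have h5 := hquot ρ z.im ⟨hδρ.le, le_rfl⟩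
            have h6 := mul_le_mul_of_nonneg_left h5 (mul_nonneg ha hρ.le)
            nlinarith [mul_nonneg hκ hρ.le]
        _ ≤ _ := by linarith
    by_cases h2 : z.re = δ
    · refine hgen z hzc ?_
      rw [h2, mul_comm]
      exact mul_le_mul_of_nonneg_right (hquot δ z.im ⟨le_rfl, hδρ.le⟩) hδ.le
    have h3 : z.im ^ 2 = ρ ^ 2 := by
      by_contra h4
      refine hz.2 ⟨⟨lt_of_le_of_ne hzc.1.1 (Ne.symm h2), lt_of_le_of_ne hzc.1.2 h1⟩,
        lt_of_le_of_ne hzc.2.1 fun h => h4 ?_, lt_of_le_of_ne hzc.2.2 fun h => h4 ?_⟩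
      · rw [← h]; ring
      · rw [h]
    refine hgen z hzc ((mul_nonpos_of_nonneg_of_nonpos hx0.le ?_).trans (by positivity))
    have : (z.re ^ 2 - 3 * z.im ^ 2) / (2 * ρ ^ 2) ≤ -1 := by
      rw [div_le_iff₀ (by positivity), h3]
      have := pow_le_pow_left₀ hx0.le hzc.1.2 2
      linarith
    linarith
  have htm : (t : ℂ) ∈ closure U := by
    rw [hcl]; exact ⟨ht, by simp; linarith⟩
  have hmax := Complex.norm_le_of_forall_mem_frontier_norm_le
    ((Metric.isBounded_Ioo δ ρ).reProdIm (Metric.isBounded_Ioo (-ρ) ρ)) hgd hfr htm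
  rw [hg] at hmax
  simp only [Complex.ofReal_re, Complex.ofReal_im] at hmax
  have ht0 : 0 < t := hδ.trans_le ht.1
  have hE : Real.exp (-(κ * t - a * t)) ≤ Real.exp (-(κ * t) +
      a * (t * (1 + (t ^ 2 - 3 * 0 ^ 2) / (2 * ρ ^ 2)))) := by
    rw [Real.exp_le_exp]
    have : 0 ≤ a * (t * ((t ^ 2 - 3 * 0 ^ 2) / (2 * ρ ^ 2))) := by
      simp only [ne_eq, OfNat.ofNat_ne_zero, not_false_eq_true, zero_pow, mul_zero, sub_zero]
      positivity
    linarith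
  have h7 := (mul_le_mul_of_nonneg_left hE (norm_nonneg (f t))).trans hmax
  rw [Real.exp_neg, ← div_eq_mul_inv, div_le_iff₀ (Real.exp_pos _)] at h7
  exact h7

/-- The decay rate `ρ j² / 2` exceeds the required `3 ρ (j + 1)² / 8` by enough to absorb the linear
terms and the constant. -/
theorem eventually_rootError_le {ρ : ℝ} (hρ : 0 < ρ) :
    ∀ᶠ j : ℕ in atTop,
      rootError ρ j ≤ Real.exp (-(3 / 2 * (((j + 1 : ℕ) : ℝ) ^ 2 / 4) * ρ)) := by
  have hd := qPochBound_pos (Real.exp (-(ρ / 2)))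
  have h1 : ∀ᶠ j : ℕ in atTop, (qPochBound (Real.exp (-(ρ / 2))) ^ 3)⁻¹ ≤ Real.exp (ρ * j) :=
    (Real.tendsto_exp_atTop.comp
      (tendsto_natCast_atTop_atTop.const_mul_atTop hρ)).eventually_ge_atTop _
  filter_upwards [h1, eventually_ge_atTop 15] with j hj hj15
  have hj' : (15 : ℝ) ≤ j := by exact_mod_cast hj15
  rw [rootError, mul_inv, ← Real.exp_neg]
  calc _ ≤ Real.exp (-(ρ * ((j : ℝ) ^ 2 - 1) / 2)) * Real.exp (ρ * j) := by gcongr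
    _ = Real.exp (-(ρ * ((j : ℝ) ^ 2 - 1) / 2) + ρ * j) := (Real.exp_add _ _).symm
    _ ≤ _ := by
      rw [Real.exp_le_exp]
      push_cast
      have : 0 ≤ ρ * ((j : ℝ) ^ 2 / 8 - 7 / 4 * j - 7 / 8) := mul_nonneg hρ.le (by nlinarith)
      nlinarith

/-- If the sector near `w` contains no spectral value, then there are roots exponentially close to
`-q^{-k}` at distance `s / k` from the boundary. -/
theorem exists_root_near_neg_inv_pow {w : ℂ} (hw : ‖w‖ = 1) {ρ : ℝ} (hρ : 0 < ρ)
    (hspec : ∀ z ∈ Set.Ioo 0 (2 * ρ) ×ℂ Set.Ioo (-(2 * ρ)) (2 * ρ),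
      w * Complex.exp (-z) ∉ partialThetaSpec) {s : ℝ} (hs : 0 < s) :
    ∀ᶠ k : ℕ in atTop, ∃ y : ℂ, y ≠ 0 ∧
      ‖y⁻¹ - 1‖ ≤ 3 * Real.exp 1 * Real.exp (s - s * k / 4) ∧
      partialTheta (w * Complex.exp (-(s / k : ℝ)))
        (-y / (w * Complex.exp (-(s / k : ℝ))) ^ k) = 0 := by
  have he : Real.exp (-(ρ / 2)) < 1 := by rw [Real.exp_lt_one_iff]; linarith
  have hw0 : w ≠ 0 := norm_pos_iff.1 (by rw [hw]; exact one_pos)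
  have hnat : ∀ c : ℝ, ∀ᶠ j : ℕ in atTop, c ≤ ((j + 1 : ℕ) : ℝ) := fun c =>
    (tendsto_natCast_atTop_atTop.comp (tendsto_add_atTop_nat 1)).eventually_ge_atTop c
  have hsmall : ∀ᶠ j : ℕ in atTop, 3 * rootError ρ j ≤
      (1 - Real.exp (-(ρ / 2))) * Real.exp (-(ρ / 2)) :=
    ((tendsto_rootError hρ).const_mul 3).eventually_le_const
      (by simpa using mul_pos (sub_pos.2 he) (Real.exp_pos _))
  suffices h : ∀ᶠ j : ℕ in atTop, ∃ y : ℂ, y ≠ 0 ∧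
      ‖y⁻¹ - 1‖ ≤ 3 * Real.exp 1 * Real.exp (s - s * (j + 1 : ℕ) / 4) ∧
      partialTheta (w * Complex.exp (-(s / (j + 1 : ℕ) : ℝ)))
        (-y / (w * Complex.exp (-(s / (j + 1 : ℕ) : ℝ))) ^ (j + 1)) = 0 by
    obtain ⟨N, hN⟩ := eventually_atTop.1 h
    refine eventually_atTop.2 ⟨N + 1, fun k hk => ?_⟩
    obtain ⟨j, rfl⟩ : ∃ j, k = j + 1 := ⟨k - 1, by omega⟩
    exact hN j (by omega)
  filter_upwards [hsmall, eventually_two_le_exp hρ, eventually_rootError_le hρ, hnat (s / ρ),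
    hnat (1 / s), hnat (1 / ρ + 1)] with j h3 h2 hedge hk1 hk2 hk3
  set k : ℕ := j + 1 with hk
  have hk0 : (0 : ℝ) < k := by rw [hk]; positivity
  -- With `a = k² / 4` in the two-constants estimate, `3/2 a δ = 3/8 ≤ 1`. Continuing the root down
  -- to `δ / 2` puts the closed rectangle inside the open domain.
  set δ : ℝ := 1 / (k : ℝ) ^ 2 with hδ
  have hδ0 : 0 < δ := by positivity
  have hρ' : 0 < 1 / ρ := by positivity
  have hδρ : δ < ρ := by
    have h1 : 1 / ρ < (k : ℝ) ^ 2 := by nlinarith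
    rw [hδ, div_lt_iff₀ (by positivity)]
    rw [div_lt_iff₀ hρ] at h1
    linarith
  have hq : ∀ z : ℂ, z.re = ρ → ‖w * Complex.exp (-z)‖ = Real.exp (-ρ) := fun z hz => by
    rw [norm_mul_exp_neg hw, hz]
  obtain ⟨y₀, hy1, hy2, hy⟩ := exists_root_of_rootError_le hρ (hq ρ (by simp)) h2 h3
  obtain ⟨ξ, hξd, hξ0, hξ⟩ := exists_differentiableOn_root_partialTheta hw (half_pos hδ0)
    (by linarith) (fun z hz => hspec z ⟨⟨(half_pos hδ0).trans hz.1.1, hz.1.2⟩, hz.2⟩) hy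
  set V := Set.Ioo (δ / 2) (2 * ρ) ×ℂ Set.Ioo (-(2 * ρ)) (2 * ρ) with hV
  have hξn : ∀ z ∈ V, 1 / 2 ≤ ‖ξ z‖ := fun z hz =>
    half_le_norm_of_partialTheta_eq_zero (q := w * Complex.exp (-z))
      (by rw [norm_mul_exp_neg hw, Real.exp_lt_one_iff]; linarith [hz.1.1]) (hξ z hz)
  have hξne : ∀ z ∈ V, ξ z ≠ 0 := fun z hz => norm_pos_iff.1 (by linarith [hξn z hz])
  have hqne : ∀ z, w * Complex.exp (-z) ≠ 0 := fun z => mul_ne_zero hw0 (Complex.exp_ne_zero _)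
  let Y : ℂ → ℂ := fun z => -(ξ z * (w * Complex.exp (-z)) ^ k)
  have hYne : ∀ z ∈ V, Y z ≠ 0 := fun z hz =>
    neg_ne_zero.2 (mul_ne_zero (hξne z hz) (pow_ne_zero _ (hqne z)))
  have hYξ : ∀ z, -Y z / (w * Complex.exp (-z)) ^ k = ξ z := fun z => by
    simp only [Y, neg_neg]; exact mul_div_cancel_right₀ _ (pow_ne_zero _ (hqne z))
  -- The inverse is used because the roots are bounded below, not above, uniformly in `z`.
  let f : ℂ → ℂ := fun z => (Y z)⁻¹ - 1
  have hYd : DifferentiableOn ℂ Y V := by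
    refine (hξd.mul (Differentiable.differentiableOn ?_)).neg
    fun_prop
  have hfd : DifferentiableOn ℂ f V := (hYd.inv hYne).sub_const 1
  have hsub : Set.Icc δ ρ ×ℂ Set.Icc (-ρ) ρ ⊆ V := fun z hz =>
    ⟨⟨by linarith [hz.1.1], by linarith [hz.1.2]⟩, by linarith [hz.2.1], by linarith [hz.2.2]⟩
  have hgrow : ∀ z ∈ Set.Icc δ ρ ×ℂ Set.Icc (-ρ) ρ, ‖f z‖ ≤ 3 * Real.exp (k * z.re) := by
    intro z hz
    have h4 := hξn z (hsub hz)
    have h5 : ‖(Y z)⁻¹‖ ≤ 2 * Real.exp (k * z.re) := by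
      rw [norm_inv, norm_neg, norm_mul, norm_pow, norm_mul_exp_neg hw, ← Real.exp_nat_mul, mul_inv,
        ← Real.exp_neg, mul_neg, neg_neg]
      gcongr
      rw [inv_le_comm₀ (by linarith) two_pos]; linarith
    have h6 : 1 ≤ Real.exp (k * z.re) :=
      Real.one_le_exp (mul_nonneg hk0.le (hδ0.le.trans hz.1.1))
    have h7 := norm_sub_le (Y z)⁻¹ 1
    rw [norm_one] at h7
    linarith
  have hline : ∀ x : ℝ, ((ρ : ℂ) + x * Complex.I).re = ρ ∧ ((ρ : ℂ) + x * Complex.I).im = x :=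
    fun x => by simp
  have hlineV : ∀ x ∈ Set.Ioo (-(2 * ρ)) (2 * ρ), (ρ : ℂ) + x * Complex.I ∈ V := by
    intro x hx
    rw [hV, Complex.mem_reProdIm, (hline x).1, (hline x).2]
    exact ⟨⟨by linarith, by linarith⟩, hx⟩
  have hεr : rootError ρ j < 1 - Real.exp (-(ρ / 2)) := by
    have h8 := rootError_pos ρ j
    nlinarith [mul_le_mul_of_nonneg_left he.le (sub_nonneg.2 he.le)]
  have hgapz : ∀ z ∈ V, z.re = ρ → Real.exp (-(ρ / 2)) ≤ ‖Y z‖ → ‖Y z‖ ≤ Real.exp (ρ / 2) →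
      ‖f z‖ ≤ rootError ρ j := by
    intro z hz hzρ ha hb
    refine norm_inv_sub_one_le_rootError hρ (hq z hzρ) ha hb h2 ?_
    rw [hYξ]; exact hξ z hz
  -- The root cannot jump to another one along the edge: the annulus estimate forbids errors in
  -- `(rootError ρ j, 1 - exp (-ρ / 2)]`.
  have htop : ∀ x ∈ Set.Ioo (-(2 * ρ)) (2 * ρ), ‖f (ρ + x * Complex.I)‖ ≤ rootError ρ j := by
    intro x hx
    refine le_of_gap (h := fun x : ℝ => ‖f (ρ + x * Complex.I)‖) (a := 2 * ρ) ?_ hεr ?_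
      (by linarith) ?_ hx
    · refine (hfd.continuousOn.comp ?_ hlineV).norm
      fun_prop
    · intro x hx hle
      have hYn := hYne _ (hlineV x hx)
      have h9 : Real.exp (-(ρ / 2)) ≤ ‖(Y (ρ + x * Complex.I))⁻¹‖ ∧
          ‖(Y (ρ + x * Complex.I))⁻¹‖ ≤ Real.exp (ρ / 2) := by
        have e1 := norm_sub_norm_le 1 (Y (ρ + x * Complex.I))⁻¹
        have e2 := norm_sub_norm_le (Y (ρ + x * Complex.I))⁻¹ 1
        rw [norm_sub_rev, norm_one] at e1
        rw [norm_one] at e2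
        have e3 := Real.add_one_le_exp (ρ / 2)
        have e4 := Real.add_one_le_exp (-(ρ / 2))
        simp only [f] at hle
        constructor <;> linarith
      rw [norm_inv] at h9
      refine hgapz _ (hlineV x hx) (hline x).1 ?_ ?_
      · rw [Real.exp_neg]
        exact inv_le_of_inv_le₀ (norm_pos_iff.2 hYn) h9.2
      · have := h9.1
        rw [Real.exp_neg] at this
        exact (inv_le_inv₀ (Real.exp_pos _) (norm_pos_iff.2 hYn)).1 this
    · have hz : ((ρ : ℂ) + (0 : ℝ) * Complex.I) = ρ := by simp
      have hY0 : Y ρ = y₀ := by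
        simp only [Y]; rw [hξ0, ← hk]
        have := pow_ne_zero k (hqne ρ)
        field_simp
      simp only [hz]
      refine hgapz ρ ?_ (by simp) (by rw [hY0]; exact hy1) (by rw [hY0]; exact hy2)
      have := hlineV 0 ⟨by linarith, by linarith⟩
      rwa [hz] at this
  have hsk : s / k ∈ Set.Icc δ ρ := by
    constructor
    · rw [hδ, div_le_div_iff₀ (by positivity) hk0]
      rw [div_le_iff₀ hs] at hk2
      nlinarith
    · rw [div_le_iff₀ hk0]
      rw [div_le_iff₀ hρ] at hk1
      linarith
  have hfin := norm_le_of_small_on_edge (f := f) (κ := k) (a := (k : ℝ) ^ 2 / 4) hδ0 hδρ hk0.le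
    (by positivity) (hfd.mono hsub) hgrow
    (fun x hx => (htop x ⟨by linarith [hx.1], by linarith [hx.2]⟩).trans hedge)
    (by rw [hδ]; field_simp; norm_num) hsk
  have hskV : ((s / k : ℝ) : ℂ) ∈ V := hsub ⟨hsk, by simp; exact hρ.le⟩
  refine ⟨Y (s / k : ℝ), hYne _ hskV, hfin.trans_eq ?_, ?_⟩
  · congr 2; field_simp
  · rw [hYξ]; exact hξ _ hskV

/-! ### Parameters on the unit circle -/

theorem analyticOnNhd_partialTheta_of_norm_le_one {w : ℂ} (hw : ‖w‖ ≤ 1) :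
    AnalyticOnNhd ℂ (partialTheta w) (Metric.ball 0 1) := by
  refine DifferentiableOn.analyticOnNhd (fun u hu => ?_) Metric.isOpen_ball
  rw [mem_ball_zero_iff] at hu
  obtain ⟨r, hur, hr⟩ := exists_between hu
  have hd : DifferentiableOn ℂ (fun u => ∑' j : ℕ, w ^ (j * (j + 1) / 2) * u ^ j)
      (Metric.ball 0 r) := by
    refine Complex.differentiableOn_tsum_of_summable_norm
      (summable_geometric_of_lt_one ((norm_nonneg u).trans hur.le) hr) (fun j => by fun_prop)
      Metric.isOpen_ball fun j v hv => ?_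
    rw [mem_ball_zero_iff] at hv
    rw [norm_mul, norm_pow, norm_pow]
    exact (mul_le_of_le_one_left (by positivity) (pow_le_one₀ (norm_nonneg _) hw)).trans
      (by gcongr)
  exact (hd.differentiableAt (Metric.isOpen_ball.mem_nhds
    (mem_ball_zero_iff.2 hur))).differentiableWithinAt

/-- Otherwise the identity theorem in the unit disk would contradict `Θ(w, 0) = 1`. -/
theorem exists_partialTheta_neg_exp_ne_zero {w : ℂ} (hw : ‖w‖ ≤ 1) {R : ℝ} (hR : 0 < R) :
    ∃ s ∈ Set.Ioc 0 R, partialTheta w (-Complex.exp (-(s : ℝ))) ≠ 0 := by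
  by_contra! h
  have hmem : -Complex.exp (-((R / 2 : ℝ) : ℂ)) ∈ Metric.ball (0 : ℂ) 1 := by
    rw [mem_ball_zero_iff, norm_neg, Complex.norm_exp, Complex.neg_re, Complex.ofReal_re,
      Real.exp_lt_one_iff]
    linarith
  have hcont : Tendsto (fun s : ℝ => -Complex.exp (-(s : ℂ))) (𝓝[≠] (R / 2))
      (𝓝[≠] (-Complex.exp (-((R / 2 : ℝ) : ℂ)))) := by
    refine tendsto_nhdsWithin_iff.2 ⟨?_, ?_⟩
    · have : Continuous fun s : ℝ => -Complex.exp (-(s : ℂ)) := by fun_prop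
      exact (this.tendsto _).mono_left nhdsWithin_le_nhds
    · refine eventually_mem_nhdsWithin.mono fun s hs h1 => hs ?_
      have h2 := neg_injective h1
      rw [← Complex.ofReal_neg, ← Complex.ofReal_neg, ← Complex.ofReal_exp, ← Complex.ofReal_exp,
        Complex.ofReal_inj, Real.exp_eq_exp] at h2
      exact neg_injective h2
  have hev : ∀ᶠ s : ℝ in 𝓝[≠] (R / 2), partialTheta w (-Complex.exp (-(s : ℂ))) = 0 := by
    have : Set.Ioc 0 R ∈ 𝓝 (R / 2) := Ioc_mem_nhds (by linarith) (by linarith)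
    filter_upwards [nhdsWithin_le_nhds this] with s hs using h s hs
  have hzero := (analyticOnNhd_partialTheta_of_norm_le_one hw).eqOn_zero_of_preconnected_of_frequently_eq_zero
    (convex_ball (0 : ℂ) 1).isPreconnected hmem (hcont.frequently hev.frequently)
  have h0 := hzero (Metric.mem_ball_self one_pos)
  have h1 : partialTheta w 0 = 1 := by
    rw [partialTheta, tsum_eq_single 0]
    · simp
    · intro j hj; simp [hj]
  rw [h1] at h0
  exact one_ne_zero h0

/-- A geometric majorant in `x` alone lets `q` reach the unit circle. -/
theorem tendsto_partialTheta {α : Type*} {l : Filter α} {q u : α → ℂ} {w v : ℂ}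
    (hq : Tendsto q l (𝓝 w)) (hu : Tendsto u l (𝓝 v)) (hq1 : ∀ᶠ a in l, ‖q a‖ ≤ 1)
    (hv : ‖v‖ < 1) : Tendsto (fun a => partialTheta (q a) (u a)) l (𝓝 (partialTheta w v)) := by
  obtain ⟨r, hvr, hr⟩ := exists_between hv
  refine tendsto_tsum_of_dominated_convergence
    (summable_geometric_of_lt_one ((norm_nonneg v).trans hvr.le) hr)
    (fun j => (hq.pow _).mul (hu.pow _)) ?_
  filter_upwards [hq1, hu.norm.eventually_le_const hvr] with a ha hua j
  rw [norm_mul, norm_pow, norm_pow]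
  exact (mul_le_of_le_one_left (by positivity) (pow_le_one₀ (norm_nonneg _) ha)).trans (by gcongr)

/-! ### The contradiction at roots of unity and density -/

/-- The bilateral theta series is exponentially small near `-q^{-k}` for `q = w exp (-s/k)`. -/
theorem norm_fullTheta_neg_div_pow_le {w y : ℂ} {n : ℕ} (hn : 0 < n) (hw : w ^ n = 1) {s R : ℝ}
    (hR : R = Real.log 2 / (16 * n)) (hs : 0 < s) (hsR : s ≤ R) {k : ℕ} (hk : 0 < k) (hy : y ≠ 0)
    (hyR : ‖Complex.log y‖ ≤ R / 8) :
    ‖fullTheta (w * Complex.exp (-(s / k : ℝ))) (-y / (w * Complex.exp (-(s / k : ℝ))) ^ k)‖ ≤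
      (1 + Real.exp R) * ((1 + 2 / s * k) * Real.exp (-(3 / 8 * R)) ^ k) := by
  have hk0 : (0 : ℝ) < k := Nat.cast_pos.2 hk
  have ht : 0 < s / k := by positivity
  have hw1 : ‖w‖ = 1 := Complex.norm_eq_one_of_pow_eq_one hw hn.ne'
  have hqn : ‖w * Complex.exp (-(s / k : ℝ))‖ = Real.exp (-(s / k)) := by
    rw [norm_mul_exp_neg hw1]; simp
  have hdec := norm_fullTheta_neg_exp_le_decay hn hw ht hR hyR
  rw [Complex.exp_log hy] at hdec
  set q := w * Complex.exp (-(s / k : ℝ)) with hq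
  have hq1 : ‖q‖ < 1 := by rw [hqn, Real.exp_lt_one_iff]; linarith
  have hq0 : q ≠ 0 := norm_pos_iff.1 (by rw [hqn]; exact Real.exp_pos _)
  have hyn : ‖y‖ ≤ Real.exp (R / 8) := by
    nth_rewrite 1 [← Complex.exp_log hy]
    rw [Complex.norm_exp, Real.exp_le_exp]
    exact (Complex.re_le_norm _).trans hyR
  obtain ⟨j, rfl⟩ : ∃ j, k = j + 1 := ⟨k - 1, by omega⟩
  rw [norm_fullTheta_div_pow hq1 hq0 (neg_ne_zero.2 hy), norm_neg, hqn, ← Real.exp_nat_mul,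
    div_eq_mul_inv (‖y‖ ^ _), ← Real.exp_neg]
  have h2 : 2 / (s / ((j + 1 : ℕ) : ℝ)) = 2 / s * (j + 1 : ℕ) := by field_simp
  rw [h2] at hdec
  have hR0 : 0 < R := hs.trans_le hsR
  calc _ ≤ Real.exp (R / 8) ^ (j + 1) *
        Real.exp (-(((j * (j + 1) / 2 : ℕ) : ℝ) * -(s / (j + 1 : ℕ)))) *
        ((1 + Real.exp R) * (1 + 2 / s * (j + 1 : ℕ)) *
          Real.exp (-(R ^ 2 / (s / (j + 1 : ℕ))))) := by gcongr
    _ = (1 + Real.exp R) * ((1 + 2 / s * (j + 1 : ℕ)) * Real.exp ((j + 1 : ℕ) * (R / 8) +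
        -(((j * (j + 1) / 2 : ℕ) : ℝ) * -(s / (j + 1 : ℕ))) + -(R ^ 2 / (s / (j + 1 : ℕ))))) := by
        rw [Real.exp_add, Real.exp_add, Real.exp_nat_mul]; ring
    _ ≤ _ := by
        rw [← Real.exp_nat_mul]
        gcongr
        rw [triangle_cast]
        -- With `s ≤ R`, the exponent per unit of `k` is at most `R / 8 + R / 2 - R = -3R / 8`: the
        -- decay beats the quasi-periodicity factor.
        have h3 : R * (j + 1 : ℕ) ≤ R ^ 2 / (s / (j + 1 : ℕ)) := by
          rw [le_div_iff₀ ht]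
          calc R * (j + 1 : ℕ) * (s / (j + 1 : ℕ)) = R * s := by field_simp
            _ ≤ R ^ 2 := by nlinarith
        have h4 : (j * (j + 1) / 2 : ℝ) * -(s / (j + 1 : ℕ)) = -(j * s / 2) := by
          push_cast; field_simp
        have h5 : (j : ℝ) * s ≤ (j + 1) * R := by
          have : (0 : ℝ) ≤ j := Nat.cast_nonneg j
          nlinarith
        rw [h4]
        push_cast at h3 ⊢
        linarith

/-- Every sector at a root of unity contains spectral values. -/
theorem exists_mem_partialThetaSpec_of_pow_eq_one {w : ℂ} {n : ℕ} (hn : 0 < n) (hw : w ^ n = 1)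
    {ρ : ℝ} (hρ : 0 < ρ) :
    ∃ z ∈ Set.Ioo 0 (2 * ρ) ×ℂ Set.Ioo (-(2 * ρ)) (2 * ρ),
      w * Complex.exp (-z) ∈ partialThetaSpec := by
  by_contra! hspec
  have hw1 : ‖w‖ = 1 := Complex.norm_eq_one_of_pow_eq_one hw hn.ne'
  have hn' : (0 : ℝ) < n := Nat.cast_pos.2 hn
  obtain ⟨R, hR⟩ : ∃ R : ℝ, R = Real.log 2 / (16 * n) := ⟨_, rfl⟩
  have hR0 : 0 < R := by rw [hR]; have := Real.log_pos one_lt_two; positivity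
  obtain ⟨s, ⟨hs, hsR⟩, hs0⟩ := exists_partialTheta_neg_exp_ne_zero hw1.le hR0
  obtain ⟨y, hy⟩ := (exists_root_near_neg_inv_pow hw1 hρ hspec hs).choice
  -- Along multiples of `n` the power `w ^ k` disappears, so `q ^ k` is exactly `exp (-s)`.
  have hφ : Tendsto (fun l : ℕ => n * (l + 1)) atTop atTop :=
    (tendsto_add_atTop_nat 1).const_mul_atTop' hn
  have hcast : Tendsto (fun l : ℕ => ((n * (l + 1) : ℕ) : ℝ)) atTop atTop :=
    tendsto_natCast_atTop_atTop.comp hφ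
  have hyl := hφ.eventually hy
  set q : ℕ → ℂ := fun l => w * Complex.exp (-(s / (n * (l + 1) : ℕ) : ℝ)) with hq
  set v : ℕ → ℂ := fun l => y (n * (l + 1)) with hv
  have hqk : ∀ l, q l ^ (n * (l + 1)) = Complex.exp (-(s : ℝ)) := by
    intro l
    have : ((n * (l + 1) : ℕ) : ℂ) ≠ 0 := by
      have : n * (l + 1) ≠ 0 := by positivity
      exact_mod_cast this
    rw [hq, mul_pow, pow_mul w, hw, one_pow, one_mul, ← Complex.exp_nat_mul]
    congr 1
    rw [Complex.ofReal_div, Complex.ofReal_natCast, mul_neg, mul_div_cancel₀ _ this]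
  have hvinv : Tendsto (fun l => (v l)⁻¹) atTop (𝓝 1) := by
    rw [tendsto_iff_norm_sub_tendsto_zero]
    have h1 : Tendsto (fun l : ℕ => 3 * Real.exp 1 *
        Real.exp (s - s * (n * (l + 1) : ℕ) / 4)) atTop (𝓝 0) := by
      rw [← mul_zero (3 * Real.exp 1)]
      refine (Real.tendsto_exp_atBot.comp ?_).const_mul _
      exact tendsto_atBot_add_const_left _ s (tendsto_neg_atTop_atBot.comp
        ((hcast.const_mul_atTop hs).atTop_div_const (by norm_num : (0 : ℝ) < 4)))
    exact squeeze_zero' (Eventually.of_forall fun _ => norm_nonneg _)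
      (hyl.mono fun l hl => hl.2.1) h1
  have hv1 : Tendsto v atTop (𝓝 1) := by simpa using hvinv.inv₀ one_ne_zero
  have hqw : Tendsto q atTop (𝓝 w) := by
    have h1 : Tendsto (fun l : ℕ => ((s / (n * (l + 1) : ℕ) : ℝ) : ℂ)) atTop (𝓝 ((0 : ℝ) : ℂ)) :=
      (Complex.continuous_ofReal.tendsto 0).comp (hcast.const_div_atTop s)
    have h2 : Tendsto q atTop (𝓝 (w * Complex.exp (-((0 : ℝ) : ℂ)))) :=
      ((Complex.continuous_exp.tendsto _).comp h1.neg).const_mul w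
    simpa using h2
  have hq1 : ∀ l, ‖q l‖ ≤ 1 := by
    intro l
    rw [hq, norm_mul_exp_neg hw1, Complex.ofReal_re, Real.exp_le_one_iff, neg_nonpos]
    positivity
  have hxinv : ∀ l, (-v l / q l ^ (n * (l + 1)))⁻¹ = -(Complex.exp (-(s : ℝ)) * (v l)⁻¹) := by
    intro l
    rw [hqk, inv_div, div_neg, div_eq_mul_inv]
  have hxlim : Tendsto (fun l => (-v l / q l ^ (n * (l + 1)))⁻¹) atTop
      (𝓝 (-Complex.exp (-(s : ℝ)))) := by
    simp_rw [hxinv]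
    simpa using (hvinv.const_mul (Complex.exp (-(s : ℝ)))).neg
  have hnorm : ‖-Complex.exp (-(s : ℝ) : ℂ)‖ < 1 := by
    rw [norm_neg, Complex.norm_exp, Complex.neg_re, Complex.ofReal_re, Real.exp_lt_one_iff]
    linarith
  have hlim := hxlim.mul (tendsto_partialTheta hqw hxlim (Eventually.of_forall hq1) hnorm)
  have hlog : ∀ᶠ l in atTop, ‖Complex.log (v l)‖ ≤ R / 8 := by
    have h1 : Tendsto (fun l => Complex.log (v l)) atTop (𝓝 (Complex.log 1)) :=
      hv1.clog (by simp)
    have h2 := h1.norm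
    rw [Complex.log_one, norm_zero] at h2
    exact h2.eventually_le_const (by positivity)
  have hzero : Tendsto (fun l => (-v l / q l ^ (n * (l + 1)))⁻¹ *
      partialTheta (q l) (-v l / q l ^ (n * (l + 1)))⁻¹) atTop (𝓝 0) := by
    have h1 : Tendsto (fun k : ℕ => (1 + Real.exp R) *
        ((1 + 2 / s * k) * Real.exp (-(3 / 8 * R)) ^ k)) atTop (𝓝 0) := by
      have hr : Real.exp (-(3 / 8 * R)) < 1 := by rw [Real.exp_lt_one_iff]; linarith
      have h2 := tendsto_pow_atTop_nhds_zero_of_lt_one (Real.exp_pos _).le hr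
      have h3 := tendsto_self_mul_const_pow_of_lt_one (Real.exp_pos _).le hr
      have h4 := (h2.add (h3.const_mul (2 / s))).const_mul (1 + Real.exp R)
      simp only [mul_zero, add_zero] at h4
      refine h4.congr fun k => ?_
      ring
    refine squeeze_zero_norm' ?_ (h1.comp hφ)
    filter_upwards [hyl, hlog] with l hl hll
    have h5 := hl.2.2
    change partialTheta (q l) (-v l / q l ^ (n * (l + 1))) = 0 at h5
    -- At a root the tail equals the bilateral series, so it inherits the exponential decay.
    rw [partialTheta_eq_fullTheta_sub, sub_eq_zero] at h5
    rw [← h5]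
    exact norm_fullTheta_neg_div_pow_le hn hw hR hs hsR (by positivity) hl.1 hll
  have := tendsto_nhds_unique hlim hzero
  rcases mul_eq_zero.1 this with h | h
  · exact Complex.exp_ne_zero _ (neg_eq_zero.1 h)
  · exact hs0 h

/-- Rational multiples of `2π` are dense among the arguments. -/
theorem exists_pow_eq_one_mem_ball {ζ : ℂ} (hζ : ‖ζ‖ = 1) {r : ℝ} (hr : 0 < r) :
    ∃ w ∈ Metric.ball ζ r, ∃ n : ℕ, 0 < n ∧ w ^ n = 1 := by
  let e : ℝ → ℂ := fun x => Complex.exp (2 * Real.pi * x * Complex.I)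
  have he : Continuous e := by fun_prop
  have hmem : (Complex.arg ζ / (2 * Real.pi)) ∈ e ⁻¹' Metric.ball ζ r := by
    have h1 := Complex.norm_mul_exp_arg_mul_I ζ
    rw [hζ, Complex.ofReal_one, one_mul] at h1
    have h2 : e (Complex.arg ζ / (2 * Real.pi)) = ζ := by
      rw [← h1]
      simp only [e]
      rw [h1]
      have : (Real.pi : ℂ) ≠ 0 := by exact_mod_cast Real.pi_ne_zero
      push_cast
      field_simp
      exact h1
    rw [Set.mem_preimage, h2]
    exact Metric.mem_ball_self hr
  obtain ⟨p, hp⟩ := (Rat.denseRange_cast (𝕜 := ℝ)).exists_mem_open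
    (Metric.isOpen_ball.preimage he) ⟨_, hmem⟩
  refine ⟨e p, hp, p.den, p.den_pos, ?_⟩
  simp only [e]
  rw [← Complex.exp_nat_mul]
  have h3 : (p.den : ℂ) * (2 * Real.pi * ((p : ℝ) : ℂ) * Complex.I) =
      (p.num : ℂ) * (2 * Real.pi * Complex.I) := by
    have h4 : ((p : ℝ) : ℂ) * p.den = p.num := by exact_mod_cast Rat.mul_den_eq_num p
    linear_combination (2 * Real.pi * Complex.I) * h4
  rw [h3, Complex.exp_int_mul_two_pi_mul_I]

theorem accPt_partialThetaSpec {ζ : ℂ} (hζ : ‖ζ‖ = 1) : AccPt ζ (𝓟 partialThetaSpec) := by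
  rw [accPt_iff_nhds]
  intro U hU
  obtain ⟨r, hr, hrU⟩ := Metric.mem_nhds_iff.1 hU
  obtain ⟨w, hwr, n, hn, hw⟩ := exists_pow_eq_one_mem_ball hζ hr
  have hc : ContinuousAt (fun z : ℂ => w * Complex.exp (-z)) 0 := by fun_prop
  obtain ⟨δ, hδ, hball⟩ := Metric.mem_nhds_iff.1
    (hc (Metric.isOpen_ball.mem_nhds (by simpa using hwr)))
  obtain ⟨z, hz, hzs⟩ := exists_mem_partialThetaSpec_of_pow_eq_one hn hw
    (by positivity : 0 < δ / 4)
  refine ⟨_, ⟨hrU (hball ?_), hzs⟩, ?_⟩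
  · rw [mem_ball_zero_iff]
    have h1 := Complex.norm_le_abs_re_add_abs_im z
    have h2 : |z.re| < δ / 2 := abs_lt.2 ⟨by linarith [hz.1.1], by linarith [hz.1.2]⟩
    have h3 : |z.im| < δ / 2 := abs_lt.2 ⟨by linarith [hz.2.1], by linarith [hz.2.2]⟩
    linarith
  · intro h
    have := hzs.1
    change w * Complex.exp (-z) = ζ at h
    rw [h, hζ] at this
    exact lt_irrefl _ this

theorem mainTheorem2 :
    (∀ ζ ∈ Metric.sphere (0 : ℂ) 1, AccPt ζ (𝓟 partialThetaSpec)) ∧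
      closure partialThetaSpec ∩ Metric.sphere (0 : ℂ) 1 = Metric.sphere (0 : ℂ) 1 := by
  have h : ∀ ζ ∈ Metric.sphere (0 : ℂ) 1, AccPt ζ (𝓟 partialThetaSpec) := fun ζ hζ =>
    accPt_partialThetaSpec (mem_sphere_zero_iff_norm.1 hζ)
  exact ⟨h, Set.inter_eq_right.2 fun ζ hζ => mem_closure_iff_clusterPt.2 (h ζ hζ).clusterPt⟩
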